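/- Let $\mathcal T$ be the Thue--Morse set, i.e. the set of natural numbers whose binary expansion contains an even number of digits $1$, and write $m\mathcal T+r=\{mt+r : t\in\mathcal T\}$. For $p\ge 1$, a deterministic finite automaton over the digits $0,\dots,2^p-1$, with a total transition function, recognizes a set $Y\subseteq\mathbb N$ in base $2^p$ if it accepts exactly those words (read most significant digit first, leading zeros allowed) whose value in base $2^p$ belongs to $Y$. There is an algorithm which, given $p\ge 1$ and a complete DFA $\mathcal A$ that recognizes a set $Y\subseteq\mathbb N$ in base $2^p$, decides whether $Y=m\mathcal T+r$ for some integers $m\ge 1$ and $0\le r\le m-1$. For each fixed $p$ it runs in time $O(N^2)$, where $N$ is the number of states of $\mathcal A$ (the implied constant depends only on $p$). Here time is the number of elementary steps of a random access machine on which every arithmetic operation on words (addition, truncated subtraction, multiplication, integer division), every comparison of two words and every memory access costs one step, and all numbers written during the computation are $O(N^2)$, again with a constant depending only on $p$, so that words have $O(\log N)$ bits. The input is the transition table of $\mathcal A$, its initial state and its set of accepting states, together with $N$ and $p$. -/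

import Mathlib

/-! ### Thue-Morse set, expansions, recognition -/

/-- The Thue-Morse set: the natural numbers whose binary expansion has an even number of `1`s. -/
def thueMorseSet : Set ℕ := {n | Even ((Nat.digits 2 n).count 1)}

/-- The set `m T + r`, where `T` is the Thue-Morse set. -/
def thueMorseAffine (m r : ℕ) : Set ℕ := (fun t => m * t + r) '' thueMorseSet

/-- The value in base `b` of a word over the digits `0, …, b - 1`, most significant digit first. -/
def wordVal {b : ℕ} (w : List (Fin b)) : ℕ := Nat.ofDigits b (w.map Fin.val).reverse

/-- The automaton `A` recognizes the set `Y` in base `b`: it accepts exactly the words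
(with any number of leading zeros) whose value in base `b` lies in `Y`. -/
def RecognizesSet {b : ℕ} {σ : Type*} (A : DFA (Fin b) σ) (Y : Set ℕ) : Prop :=
  A.accepts = {w : List (Fin b) | wordVal w ∈ Y}

/-! ### Random access machines with unit cost and bounded words -/

namespace RAM

/-- The contents of the machine: registers and random-access arrays, both holding natural numbers.
A program names its registers and arrays explicitly, hence uses finitely many of them. -/
structure Store where
  reg : ℕ → ℕ
  arr : ℕ → ℕ → ℕ

/-- Replace the content of register `x` by `v`. -/
def Store.setReg (s : Store) (x v : ℕ) : Store :=
  { s with reg := Function.update s.reg x v }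

/-- Replace the content of cell `i` of array `a` by `v`. -/
def Store.setArr (s : Store) (a i v : ℕ) : Store :=
  { s with arr := Function.update s.arr a (Function.update (s.arr a) i v) }

/-- Arithmetic operations on words. -/
inductive Op
  | add | sub | mul | div

/-- Subtraction is truncated at `0`; division is rounded down, and division by `0` gives `0`. -/
def Op.eval : Op → ℕ → ℕ → ℕ
  | .add, m, n => m + n
  | .sub, m, n => m - n
  | .mul, m, n => m * n
  | .div, m, n => m / n

/-- Tests: comparisons of two registers. -/
inductive Test
  | lt (x y : ℕ)
  | eq (x y : ℕ)

def Test.holds : Test → Store → Prop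
  | .lt x y, s => s.reg x < s.reg y
  | .eq x y, s => s.reg x = s.reg y

/-- Programs. -/
inductive Program
  /-- do nothing -/
  | skip
  /-- `x := n`, where `n` is a constant written in the program -/
  | const (x n : ℕ)
  /-- `x := y o z` -/
  | op (o : Op) (x y z : ℕ)
  /-- `x := a[y]` (array `a`, index in register `y`) -/
  | load (x a y : ℕ)
  /-- `a[x] := y` (array `a`, index in register `x`) -/
  | store (a x y : ℕ)
  | seq (P Q : Program)
  | ite (c : Test) (P Q : Program)
  | while (c : Test) (P : Program)

/-- `Exec W P s t s'`: on a machine whose words hold the numbers `0, …, W`, the program `P`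
started in `s` halts after exactly `t` elementary steps in `s'`. Every assignment and every
test is one step. An execution that would write a number exceeding `W` is not an execution. -/
inductive Exec (W : ℕ) : Program → Store → ℕ → Store → Prop
  | skip (s : Store) : Exec W .skip s 1 s
  | const (s : Store) (x n : ℕ) (h : n ≤ W) : Exec W (.const x n) s 1 (s.setReg x n)
  | op (s : Store) (o : Op) (x y z : ℕ) (h : o.eval (s.reg y) (s.reg z) ≤ W) :
      Exec W (.op o x y z) s 1 (s.setReg x (o.eval (s.reg y) (s.reg z)))
  | load (s : Store) (x a y : ℕ) (h : s.arr a (s.reg y) ≤ W) :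
      Exec W (.load x a y) s 1 (s.setReg x (s.arr a (s.reg y)))
  | store (s : Store) (a x y : ℕ) (h : s.reg y ≤ W) :
      Exec W (.store a x y) s 1 (s.setArr a (s.reg x) (s.reg y))
  | seq {P Q : Program} {s s₁ s₂ : Store} {t₁ t₂ : ℕ}
      (h₁ : Exec W P s t₁ s₁) (h₂ : Exec W Q s₁ t₂ s₂) : Exec W (.seq P Q) s (t₁ + t₂) s₂
  | iteTrue {c : Test} {P Q : Program} {s s₁ : Store} {t : ℕ}
      (hc : c.holds s) (h : Exec W P s t s₁) : Exec W (.ite c P Q) s (1 + t) s₁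
  | iteFalse {c : Test} {P Q : Program} {s s₁ : Store} {t : ℕ}
      (hc : ¬ c.holds s) (h : Exec W Q s t s₁) : Exec W (.ite c P Q) s (1 + t) s₁
  | whileFalse {c : Test} {P : Program} {s : Store}
      (hc : ¬ c.holds s) : Exec W (.while c P) s 1 s
  | whileTrue {c : Test} {P : Program} {s s₁ s₂ : Store} {t₁ t₂ : ℕ}
      (hc : c.holds s) (h₁ : Exec W P s t₁ s₁) (h₂ : Exec W (.while c P) s₁ t₂ s₂) :
      Exec W (.while c P) s (1 + t₁ + t₂) s₂

/-- Executions are deterministic: the result and the number of steps are determined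
by the program and the initial contents. -/
theorem Exec.deterministic {W : ℕ} {P : Program} {s s₁ s₂ : Store} {t₁ t₂ : ℕ}
    (h₁ : Exec W P s t₁ s₁) (h₂ : Exec W P s t₂ s₂) : t₁ = t₂ ∧ s₁ = s₂ := by
  induction h₁ generalizing t₂ s₂ with
  | seq _ _ ih₁ ih₂ =>
    cases h₂ with
    | seq a b =>
      obtain ⟨rfl, rfl⟩ := ih₁ a
      obtain ⟨rfl, rfl⟩ := ih₂ b
      exact ⟨rfl, rfl⟩
  | iteTrue hc _ ih =>
    cases h₂ with
    | iteTrue _ a => obtain ⟨rfl, rfl⟩ := ih a; exact ⟨rfl, rfl⟩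
    | iteFalse hn _ => exact absurd hc hn
  | iteFalse hc _ ih =>
    cases h₂ with
    | iteTrue hn _ => exact absurd hn hc
    | iteFalse _ a => obtain ⟨rfl, rfl⟩ := ih a; exact ⟨rfl, rfl⟩
  | whileFalse hc =>
    cases h₂ with
    | whileFalse _ => exact ⟨rfl, rfl⟩
    | whileTrue hn _ _ => exact absurd hn hc
  | whileTrue hc _ _ ih₁ ih₂ =>
    cases h₂ with
    | whileFalse hn => exact absurd hc hn
    | whileTrue _ a b =>
      obtain ⟨rfl, rfl⟩ := ih₁ a
      obtain ⟨rfl, rfl⟩ := ih₂ b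
      exact ⟨rfl, rfl⟩
  | _ => cases h₂; exact ⟨rfl, rfl⟩

open Classical in
/-- The initial contents of the machine for the input `A`, a DFA with states `0, …, N - 1` over the
digits `0, …, 2 ^ p - 1`. Registers `0, 1, 2` hold `N`, `p` and the initial state. Array `0` holds
the transition table row by row (the cell `i * 2 ^ p + d` holds the state reached from `i` by
reading `d`), and array `1` marks the accepting states by `1`. Everything else is `0`. -/
noncomputable def inputStore (p N : ℕ) (A : DFA (Fin (2 ^ p)) (Fin N)) : Store where
  reg := fun x =>
    if x = 0 then N else if x = 1 then p else if x = 2 then (A.start : ℕ) else 0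
  arr := fun a j =>
    if a = 0 then
      if h : j < N * 2 ^ p then
        (A.step ⟨j / 2 ^ p, Nat.div_lt_of_lt_mul (by rwa [Nat.mul_comm] at h)⟩
          ⟨j % 2 ^ p, Nat.mod_lt _ (by positivity)⟩ : ℕ)
      else 0
    else if a = 1 then
      if h : j < N then (if (⟨j, h⟩ : Fin N) ∈ A.accept then 1 else 0) else 0
    else 0

end RAM

set_option linter.constructorNameAsVariable false
set_option linter.unusedSimpArgs false

/-! ### Thue-Morse parity -/

/-! Write `b = 2 ^ p`, and let `A` have `N` states. For `r < m`, membership of `n` in `m T + r`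
depends only on `n % m` and on the digit parity of `n / m`. Both can be updated when a base-`b`
digit is appended to `n`, since a base-`b` digit is a block of `p` binary digits. So `m T + r` has
an automaton with `2 * m` states. Once a candidate `(m, r)` with `m = O(N)` is known, it is tested
by exploring the reachable part of the product of this automaton with `A`, which has `O(N ^ 2)`
vertices (`vertex_append_singleton`, `spec_checkCandidate`).

The modulus can be exponential in `N`, but only through factors `b`. If `b ∣ m`, all elements of `m
T + r` share their last digit, and deleting it leaves `(m / b) T + r / b`. Conversely, a shared last
digit forces `b ∣ 3 * m`, because `0` and `3` lie in `T`, and hence `b ∣ m`. Deleting a shared digit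
therefore preserves and reflects the property in question, for arbitrary sets
(`UniqueDigit.isAffine_iff`), and on the automaton it only changes the accepting states. If `b ^ i ∣
m`, a counting argument yields more than `i` states (`lt_card_of_two_pow_dvd`), so `N` rounds of
deletion exhaust the factors `b`. Afterwards `b ∤ m`. The odd part of `m` is at most `N`, since
prefixes in different residue classes modulo the odd part need different states; thus `m ≤ b * N`
(`le_two_pow_mul_card`).

The two least elements of `T` are `0` and `3`, so those of `m T + r` are `r` and `r + 3 * m`, both
below `4 * b * N`. Running `A` on all numbers below this limit reveals `m` and `r`. If the set is
not affine, the candidate is meaningless, but the final comparison is exact and rejects it.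

The algorithm is written in a language of loops whose numbers of rounds are bounded in advance, so
that its running time is bounded by a closed expression. `Cmd.exec_compile` transfers it to the
machine; `Spec` treats correctness and the bound on all written numbers together. -/

/-- The parity of the number of binary digits `1` of `n`. -/
def tmBit (n : ℕ) : ℕ := (Nat.digits 2 n).count 1 % 2

theorem mem_thueMorseSet_iff (n : ℕ) : n ∈ thueMorseSet ↔ tmBit n = 0 :=
  Nat.even_iff

theorem tmBit_lt_two (n : ℕ) : tmBit n < 2 := Nat.mod_lt _ (by norm_num)

theorem tmBit_zero : tmBit 0 = 0 := by simp [tmBit]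

theorem tmBit_eq_half (n : ℕ) : tmBit n = (tmBit (n / 2) + n) % 2 := by
  rcases Nat.eq_zero_or_pos n with rfl | h
  · simp [tmBit]
  · unfold tmBit
    rw [Nat.digits_def' (by norm_num) h, List.count_cons]
    rcases Nat.mod_two_eq_zero_or_one n with h2 | h2 <;> rw [h2] <;> simp <;> omega

/-- The binary expansion of `a * 2 ^ p + c` is that of `a` followed by a block of `p` digits for
`c`: no carries occur. -/
theorem tmBit_mul_two_pow_add (p a c : ℕ) (hc : c < 2 ^ p) :
    tmBit (a * 2 ^ p + c) = (tmBit a + tmBit c) % 2 := by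
  induction p generalizing c with
  | zero =>
    have : c = 0 := by simpa using hc
    have := tmBit_lt_two a
    subst c
    simp [tmBit_zero]
    omega
  | succ p ih =>
    rw [tmBit_eq_half (a * 2 ^ (p + 1) + c), tmBit_eq_half c]
    have h1 : a * 2 ^ (p + 1) = 2 * (a * 2 ^ p) := by ring
    have h2 : (a * 2 ^ (p + 1) + c) / 2 = a * 2 ^ p + c / 2 := by omega
    rw [h2, ih (c / 2) (by rw [pow_succ] at hc; omega)]
    omega

/-- `2 * s` and `2 * s + 1` differ in the last binary digit only, so exactly one of them lies in
`T`. -/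
theorem exists_tmBit_eq_zero (s : ℕ) : ∃ t, 2 * s ≤ t ∧ t < 2 * s + 2 ∧ tmBit t = 0 := by
  have h0 := tmBit_eq_half (2 * s)
  have h1 := tmBit_eq_half (2 * s + 1)
  have h2 : (2 * s + 1) / 2 = s := by omega
  have h3 : (2 * s) / 2 = s := by omega
  rw [h2] at h1
  rw [h3] at h0
  rcases Nat.mod_two_eq_zero_or_one (tmBit s) with h | h
  · exact ⟨2 * s, le_rfl, by omega, by omega⟩
  · exact ⟨2 * s + 1, by omega, by omega, by omega⟩

theorem card_tmBit_eq_zero (c : ℕ) :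
    ((Finset.range (2 * c)).filter (fun t => tmBit t = 0)).card = c := by
  induction c with
  | zero => simp
  | succ c ih =>
    have h0 := tmBit_eq_half (2 * c)
    have h1 := tmBit_eq_half (2 * c + 1)
    have h2 : (2 * c + 1) / 2 = c := by omega
    have h3 : (2 * c) / 2 = c := by omega
    rw [h2] at h1
    rw [h3] at h0
    rw [show 2 * (c + 1) = 2 * c + 1 + 1 by ring, Finset.range_add_one, Finset.range_add_one,
      Finset.filter_insert, Finset.filter_insert]
    rcases Nat.mod_two_eq_zero_or_one (tmBit c) with h | h
    · rw [if_neg (by omega), if_pos (by omega), Finset.card_insert_of_notMem (by simp), ih]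
    · rw [if_pos (by omega), if_neg (by omega), Finset.card_insert_of_notMem (by simp), ih]

/-! ### The sets `m T + r` -/

/-- The right-hand side names the data that an automaton for `m T + r` has to remember: the residue,
and the parity of the quotient. -/
theorem mem_thueMorseAffine_iff {m r : ℕ} (h : r < m) (n : ℕ) :
    n ∈ thueMorseAffine m r ↔ n % m = r ∧ tmBit (n / m) = 0 := by
  simp only [thueMorseAffine, Set.mem_image, mem_thueMorseSet_iff]
  constructor
  · rintro ⟨t, ht, rfl⟩
    have h1 : (m * t + r) / m = t := by
      rw [Nat.mul_add_div (by omega), Nat.div_eq_of_lt h, add_zero]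
    rw [h1, Nat.mul_add_mod, Nat.mod_eq_of_lt h]
    exact ⟨rfl, ht⟩
  · rintro ⟨h1, h2⟩
    exact ⟨n / m, h2, by rw [← h1, Nat.div_add_mod]⟩

theorem mul_add_mem_thueMorseAffine_iff {m r : ℕ} (h : r < m) (t : ℕ) :
    m * t + r ∈ thueMorseAffine m r ↔ tmBit t = 0 := by
  rw [mem_thueMorseAffine_iff h, Nat.mul_add_mod, Nat.mod_eq_of_lt h,
    Nat.mul_add_div (by omega), Nat.div_eq_of_lt h]
  simp

theorem tmBit_three : tmBit 3 = 0 := by simp [tmBit]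

/-- Removing the last digit in base `c` from the elements of `m T + r`, where `c` divides `m`. -/
theorem mul_add_mem_thueMorseAffine_mul {c m r : ℕ} (hc : 0 < c) (h : r < m * c) (n d : ℕ)
    (hd : d < c) :
    n * c + d ∈ thueMorseAffine (m * c) r ↔ d = r % c ∧ n ∈ thueMorseAffine m (r / c) := by
  have hr : r / c < m := Nat.div_lt_of_lt_mul (by rwa [mul_comm])
  rw [mem_thueMorseAffine_iff h, mem_thueMorseAffine_iff hr]
  have h1 : (n * c + d) / (m * c) = n / m := by
    rw [mul_comm m c, ← Nat.div_div_eq_div_mul, mul_comm n c, Nat.mul_add_div hc,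
      Nat.div_eq_of_lt hd, add_zero]
  have h2 : (n * c + d) % (m * c) = (n % m) * c + d := by
    have hlt : (n % m) * c + d < m * c := by
      have : n % m + 1 ≤ m := Nat.mod_lt _ (Nat.pos_of_ne_zero (by rintro rfl; simp at h))
      nlinarith
    have : n * c + d = (n % m) * c + d + m * c * (n / m) := by
      conv_lhs => rw [← Nat.div_add_mod n m]
      ring
    rw [this, Nat.add_mul_mod_self_left, Nat.mod_eq_of_lt hlt]
  rw [h1, h2]
  constructor
  · rintro ⟨h3, h4⟩
    subst r
    refine ⟨?_, ?_, h4⟩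
    · rw [Nat.mul_add_mod', Nat.mod_eq_of_lt hd]
    · rw [mul_comm, Nat.mul_add_div hc, Nat.div_eq_of_lt hd, add_zero]
  · rintro ⟨h3, h4, h5⟩
    refine ⟨?_, h5⟩
    rw [h4, h3, Nat.div_add_mod']

/-- Applied to the elements `r` and `r + 3 * m` of `m T + r`, which come from `0` and `3` in `T`. -/
theorem add_mul_mod_ne {c m r : ℕ} (h2 : c.Coprime 3) (h : ¬ c ∣ m) :
    r % c ≠ (r + 3 * m) % c := by
  intro he
  have h3 : c ∣ (r + 3 * m) - r := (Nat.modEq_iff_dvd' (by omega)).1 he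
  rw [Nat.add_sub_cancel_left] at h3
  exact h (h2.dvd_of_dvd_mul_left h3)

/-! ### Words and recognition -/

theorem wordVal_nil {b : ℕ} : wordVal ([] : List (Fin b)) = 0 := by simp [wordVal]

theorem wordVal_append {b : ℕ} (v w : List (Fin b)) :
    wordVal (v ++ w) = wordVal v * b ^ w.length + wordVal w := by
  simp only [wordVal, List.map_append, List.reverse_append, Nat.ofDigits_append, List.length_reverse,
    List.length_map]
  ring

theorem wordVal_append_singleton {b : ℕ} (v : List (Fin b)) (d : Fin b) :
    wordVal (v ++ [d]) = wordVal v * b + d := by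
  rw [wordVal_append]
  simp [wordVal]

theorem exists_word_length {b : ℕ} (l n : ℕ) (h : n < b ^ l) :
    ∃ w : List (Fin b), w.length = l ∧ wordVal w = n := by
  induction l generalizing n with
  | zero => exact ⟨[], rfl, by rw [wordVal_nil]; simp at h; omega⟩
  | succ l ih =>
    have hb : 0 < b := by
      rcases Nat.eq_zero_or_pos b with rfl | hb
      · simp at h
      · exact hb
    obtain ⟨w, hw, hv⟩ := ih (n / b) (Nat.div_lt_of_lt_mul (by rwa [mul_comm, ← pow_succ]))
    exact ⟨w ++ [⟨n % b, Nat.mod_lt _ hb⟩], by simp [hw],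
      by rw [wordVal_append_singleton, hv]; exact Nat.div_add_mod' n b⟩

theorem exists_word {b : ℕ} (hb : 1 < b) (n : ℕ) : ∃ w : List (Fin b), wordVal w = n := by
  obtain ⟨w, -, h⟩ := exists_word_length n n (Nat.lt_pow_self hb)
  exact ⟨w, h⟩

/-- With the accepting states `F`, the automaton `A` recognizes `Y`. -/
def RecognizesWith {b : ℕ} {σ : Type*} (A : DFA (Fin b) σ) (F : Set σ) (Y : Set ℕ) : Prop :=
  ∀ w, A.eval w ∈ F ↔ wordVal w ∈ Y

theorem RecognizesSet.recognizesWith {b : ℕ} {σ : Type*} {A : DFA (Fin b) σ} {Y : Set ℕ}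
    (h : RecognizesSet A Y) : RecognizesWith A A.accept Y := by
  intro w
  have : w ∈ A.accepts ↔ wordVal w ∈ Y := by rw [h]; rfl
  exact this

/-- Fixing a suffix leaves the transitions alone and only moves the accepting set. Hence many sets
are recognized by the same states, which gives lower bounds on their number. -/
theorem RecognizesWith.quotient {b : ℕ} {σ : Type*} {A : DFA (Fin b) σ} {F : Set σ} {Y : Set ℕ}
    (h : RecognizesWith A F Y) (w : List (Fin b)) :
    RecognizesWith A {q | A.evalFrom q w ∈ F} {n | n * b ^ w.length + wordVal w ∈ Y} := by
  intro v
  have := h (v ++ w)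
  rw [wordVal_append, DFA.eval, DFA.evalFrom_of_append] at this
  exact this

theorem RecognizesWith.step {b : ℕ} {σ : Type*} {A : DFA (Fin b) σ} {F : Set σ} {Y : Set ℕ}
    (h : RecognizesWith A F Y) (d : Fin b) :
    RecognizesWith A {q | A.step q d ∈ F} {n | n * b + d ∈ Y} := by
  intro v
  have := h (v ++ [d])
  rw [wordVal_append_singleton, DFA.eval_append_singleton] at this
  exact this

/-! ### Lower bounds for the number of states -/

theorem sum_two_pow_mul_lt {p : ℕ} (hp : 1 ≤ p) (j : ℕ) :
    ∑ l ∈ Finset.range j, 2 ^ (p * l) < 2 ^ (p * j) := by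
  induction j with
  | zero => simp
  | succ j ih =>
    rw [Finset.sum_range_succ]
    calc _ < 2 ^ (p * j) + 2 ^ (p * j) := by omega
      _ = 2 ^ (p * j + 1) := by ring
      _ ≤ _ := Nat.pow_le_pow_right (by norm_num) (by rw [Nat.mul_succ]; omega)

/-- Since `r < m`, the elements below `2 * m * c` are those with `t < 2 * c`, and half of these `t`
lie in `T`. -/
theorem card_thueMorseAffine_range {m r c : ℕ} (h : r < m) [DecidablePred (· ∈ thueMorseAffine m r)] :
    ((Finset.range (2 * (m * c))).filter (· ∈ thueMorseAffine m r)).card = c := by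
  have h1 : (Finset.range (2 * (m * c))).filter (· ∈ thueMorseAffine m r) =
      ((Finset.range (2 * c)).filter (fun t => tmBit t = 0)).image (fun t => m * t + r) := by
    ext n
    simp only [Finset.mem_filter, Finset.mem_range, Finset.mem_image]
    constructor
    · rintro ⟨h2, t, ht, rfl⟩
      refine ⟨t, ⟨?_, (mem_thueMorseSet_iff t).1 ht⟩, rfl⟩
      by_contra h3
      have : m * (2 * c) ≤ m * t := Nat.mul_le_mul_left _ (by omega)
      simp only at h2
      have h4 : m * (2 * c) = 2 * (m * c) := by ring
      omega
    · rintro ⟨t, ⟨h2, h3⟩, rfl⟩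
      refine ⟨?_, (mul_add_mem_thueMorseAffine_iff h t).2 h3⟩
      have : m * (t + 1) ≤ m * (2 * c) := Nat.mul_le_mul_left _ (by omega)
      nlinarith
  rw [h1, Finset.card_image_of_injective, card_tmBit_eq_zero]
  intro a b hab
  have : m * a = m * b := by simpa using hab
  exact Nat.eq_of_mul_eq_mul_left (by omega) this

open Classical in
/-- An automaton recognizing `m T + r` in base `2 ^ p` has more than `i` states
if `2 ^ (p * i)` divides `m`. -/
theorem lt_card_of_two_pow_dvd {p N i m r : ℕ} (hp : 1 ≤ p) {A : DFA (Fin (2 ^ p)) (Fin N)}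
    {F : Set (Fin N)} (hr : r < m) (hA : RecognizesWith A F (thueMorseAffine m r))
    (hi : 2 ^ (p * i) ∣ m) : i < N := by
  have hb : 1 < 2 ^ p := Nat.one_lt_two_pow (by omega)
  have hdiv : ∀ j ≤ i, m / 2 ^ (p * j) * 2 ^ (p * j) = m := fun j hj =>
    Nat.div_mul_cancel ((Nat.pow_dvd_pow 2 (Nat.mul_le_mul_left p hj)).trans hi)
  have hword : ∀ j, ∃ w : List (Fin (2 ^ p)), w.length = j ∧ wordVal w = r % 2 ^ (p * j) := by
    intro j
    exact exists_word_length _ _ (by rw [← pow_mul]; exact Nat.mod_lt _ (by positivity))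
  choose w hwl hwv using hword
  -- Deleting the last `j` digits of `r` from `m T + r` gives `Y j`, which `A` recognizes with
  -- accepting states `G j`.
  let Y : ℕ → Set ℕ := fun j => thueMorseAffine (m / 2 ^ (p * j)) (r / 2 ^ (p * j))
  let G : ℕ → Set (Fin N) := fun j => {q | A.evalFrom q (w j) ∈ F}
  have hrj : ∀ j ≤ i, r / 2 ^ (p * j) < m / 2 ^ (p * j) := by
    intro j hj
    refine Nat.div_lt_of_lt_mul ?_
    rw [mul_comm, hdiv j hj]; exact hr
  have hG : ∀ j ≤ i, RecognizesWith A (G j) (Y j) := by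
    intro j hj v
    rw [hA.quotient (w j) v, Set.mem_ofPred_eq, hwl, hwv, ← pow_mul]
    have := mul_add_mem_thueMorseAffine_mul (c := 2 ^ (p * j)) (m := m / 2 ^ (p * j)) (r := r)
      (by positivity) (by rw [hdiv j hj]; exact hr) (wordVal v) (r % 2 ^ (p * j))
      (Nat.mod_lt _ (by positivity))
    rw [hdiv j hj] at this
    rw [this]
    simp [Y]
  have hcard : ∀ j ≤ i, ((Finset.range (2 * m)).filter (· ∈ Y j)).card = 2 ^ (p * j) := by
    intro j hj
    have := card_thueMorseAffine_range (c := 2 ^ (p * j)) (hrj j hj)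
    rwa [hdiv j hj] at this
  -- Below `2 * m` the set `Y j` has `2 ^ (p * j)` elements, more than all the earlier `Y l`
  -- together, so they cannot cover it.
  have hex : ∀ j ≤ i, ∃ v ∈ Y j, ∀ l < j, v ∉ Y l := by
    intro j hj
    by_contra! hcon
    have hsub : (Finset.range (2 * m)).filter (· ∈ Y j) ⊆
        (Finset.range j).biUnion (fun l => (Finset.range (2 * m)).filter (· ∈ Y l)) := by
      intro v hv
      rw [Finset.mem_filter] at hv
      obtain ⟨l, hl, hvl⟩ := hcon v hv.2
      exact Finset.mem_biUnion.2 ⟨l, Finset.mem_range.2 hl, Finset.mem_filter.2 ⟨hv.1, hvl⟩⟩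
    have h1 := (Finset.card_le_card hsub).trans Finset.card_biUnion_le
    rw [hcard j hj, Finset.sum_congr rfl (fun l hl => hcard l
      ((Finset.mem_range.1 hl).le.trans hj))] at h1
    exact absurd h1 (not_le.2 (sum_two_pow_mul_lt hp j))
  choose! v hv hv' using hex
  choose u hu using exists_word hb
  -- For `l < j`, the accepting set `G l` separates the states reached by `v l` and `v j`, so there
  -- are `i + 1` different states.
  have hinj : Function.Injective (fun j : Fin (i + 1) => A.eval (u (v j))) := by
    have key : ∀ j l : ℕ, j ≤ i → l < j → A.eval (u (v l)) ≠ A.eval (u (v j)) := by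
      intro j l hj hl he
      have h1 := hG l (hl.le.trans hj) (u (v l))
      have h2 := hG l (hl.le.trans hj) (u (v j))
      rw [hu] at h1 h2
      exact hv' j hj l hl (h2.1 (he ▸ h1.2 (hv l (hl.le.trans hj))))
    intro j l he
    rcases lt_trichotomy (j : ℕ) l with h | h | h
    · exact absurd he (key l j (by omega) h)
    · exact Fin.ext h
    · exact absurd he.symm (key j l (by omega) h)
  have := Fintype.card_le_of_injective _ hinj
  simpa using this

/-- An automaton with `N` states recognizing `m T + r` in base `2 ^ p`, where `2 ^ p` does not
divide `m`, satisfies `m ≤ 2 ^ p * N`. -/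
theorem le_two_pow_mul_card {p N m r : ℕ} (hp : 1 ≤ p) {A : DFA (Fin (2 ^ p)) (Fin N)}
    {F : Set (Fin N)} (hr : r < m) (hA : RecognizesWith A F (thueMorseAffine m r))
    (hm : ¬ 2 ^ p ∣ m) : m ≤ 2 ^ p * N := by
  have hb : 1 < 2 ^ p := Nat.one_lt_two_pow (by omega)
  obtain ⟨z, k, hk, hzk⟩ := Nat.exists_eq_two_pow_mul_odd (n := m) (by omega)
  have hz : z < p := by
    by_contra hz
    exact hm (hzk ▸ (Nat.pow_dvd_pow 2 (by omega)).trans (dvd_mul_right _ _))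
  suffices hkN : k ≤ N by
    rw [hzk]
    exact Nat.mul_le_mul (Nat.pow_le_pow_right (by norm_num) hz.le) hkN
  choose u hu using exists_word hb
  have hinj : Function.Injective (fun j : Fin k => A.eval (u j)) := by
    intro a b hab
    simp only at hab
    -- The numbers `a * c + x` with `x < c` are the continuations of the prefix `a` by `l` digits.
    -- As `c > 4 * m`, this block contains an element `m * t + r`: the chosen `t` makes it exceed `a
    -- * c` by less than `4 * m`.
    set l := 4 * m with hl
    set c := (2 ^ p) ^ l with hc
    have hcm : 4 * m < c := Nat.lt_pow_self hb
    obtain ⟨t, ht1, ht2, ht⟩ := exists_tmBit_eq_zero ((a * c) / (2 * m) + 1)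
    have hdm := Nat.div_add_mod (a * c) (2 * m)
    have hlt := Nat.mod_lt (a * c) (show 0 < 2 * m by omega)
    set s := (a * c) / (2 * m) with hs
    have h1 : m * (2 * (s + 1)) ≤ m * t := Nat.mul_le_mul_left _ ht1
    have h2 : m * (t + 1) ≤ m * (2 * (s + 1) + 2) := Nat.mul_le_mul_left _ (by omega)
    obtain ⟨x, hx⟩ : ∃ x, m * t + r = a * c + x :=
      Nat.exists_eq_add_of_le (by nlinarith)
    have h6 : m * (2 * (s + 1) + 2) = 2 * m * s + 4 * m := by ring
    have h7 : m * (t + 1) = m * t + m := by ring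
    have hxc : x < c := by omega
    obtain ⟨w, hwl, hwv⟩ := exists_word_length l x hxc
    have ha := hA.quotient w (u a)
    have hb' := hA.quotient w (u b)
    rw [hu, Set.mem_ofPred_eq, hwl, hwv] at ha hb'
    rw [← hab] at hb'
    have hma : (a : ℕ) * c + x ∈ thueMorseAffine m r := by
      rw [← hx]; exact (mul_add_mem_thueMorseAffine_iff hr t).2 ht
    have hmb : (b : ℕ) * c + x ∈ thueMorseAffine m r := hb'.1 (ha.2 hma)
    rw [mem_thueMorseAffine_iff hr] at hma hmb
    have h3 : (a : ℕ) * c + x ≡ b * c + x [MOD m] := hma.1.trans hmb.1.symm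
    -- The same suffix is accepted after `a` and after `b`. Modulo the odd `k`, the power of two `c`
    -- can then be cancelled.
    have h4 : (a : ℕ) * c ≡ b * c [MOD k] :=
      (Nat.ModEq.add_right_cancel' x h3).of_dvd (hzk ▸ dvd_mul_left _ _)
    have hcop : Nat.gcd k c = 1 := by
      rw [hc, ← pow_mul]
      exact Nat.Coprime.pow_right _ (Nat.Coprime.symm (Nat.coprime_two_left.2 hk))
    have h5 : (a : ℕ) ≡ b [MOD k] := Nat.ModEq.cancel_right_of_coprime hcop h4
    exact Fin.ext (Nat.ModEq.eq_of_lt_of_lt h5 a.2 b.2)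
  simpa using Fintype.card_le_of_injective _ hinj

/-! ### A small language of bounded loops, compiled to random access machines -/

/-- The variables of the programs below. -/
inductive Var
  | N | p | start | base | i | q | d | cnt | sel | fnd | n | r | m | lim | size | h | tail | v | e
  | j | x | w | t | ok
  deriving DecidableEq

/-- The arrays of the programs below. -/
inductive Arr
  | delta | acc | reach | new | state | bits | visited | queue
  deriving DecidableEq

def Var.toNat : Var → ℕ
  | .N => 0 | .p => 1 | .start => 2 | .base => 3 | .i => 4 | .q => 5 | .d => 6 | .cnt => 7
  | .sel => 8 | .fnd => 9 | .n => 10 | .r => 11 | .m => 12 | .lim => 13 | .size => 14 | .h => 15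
  | .tail => 16 | .v => 17 | .e => 18 | .j => 19 | .x => 20 | .w => 21 | .t => 22 | .ok => 23

def Arr.toNat : Arr → ℕ
  | .delta => 0 | .acc => 1 | .reach => 2 | .new => 3 | .state => 4 | .bits => 5 | .visited => 6
  | .queue => 7

theorem Var.toNat_injective : Function.Injective Var.toNat := by
  intro x y
  cases x <;> cases y <;> simp [Var.toNat]

theorem Arr.toNat_injective : Function.Injective Arr.toNat := by
  intro x y
  cases x <;> cases y <;> simp [Arr.toNat]

theorem Var.toNat_lt (x : Var) : x.toNat < 24 := by
  cases x <;> simp [Var.toNat]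

/-- The values of the variables and arrays. -/
structure State where
  reg : Var → ℕ
  arr : Arr → ℕ → ℕ

def State.setReg (s : State) (x : Var) (v : ℕ) : State :=
  { s with reg := Function.update s.reg x v }

def State.setArr (s : State) (a : Arr) (i v : ℕ) : State :=
  { s with arr := Function.update s.arr a (Function.update (s.arr a) i v) }

@[simp] theorem State.setReg_reg (s : State) (x : Var) (v : ℕ) (y : Var) :
    (s.setReg x v).reg y = if y = x then v else s.reg y := by
  simp [State.setReg, Function.update_apply]

@[simp] theorem State.setReg_arr (s : State) (x : Var) (v : ℕ) : (s.setReg x v).arr = s.arr := rfl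

@[simp] theorem State.setArr_reg (s : State) (a : Arr) (i v : ℕ) :
    (s.setArr a i v).reg = s.reg := rfl

@[simp] theorem State.setArr_arr (s : State) (a : Arr) (i v : ℕ) (b : Arr) :
    (s.setArr a i v).arr b = if b = a then Function.update (s.arr a) i v else s.arr b := by
  simp [State.setArr, Function.update_apply]

/-- All values are at most `W`. -/
def State.Bounded (W : ℕ) (s : State) : Prop :=
  (∀ x, s.reg x ≤ W) ∧ ∀ a j, s.arr a j ≤ W

theorem State.Bounded.setReg {W : ℕ} {s : State} (h : s.Bounded W) (x : Var) {v : ℕ} (hv : v ≤ W) :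
    (s.setReg x v).Bounded W := by
  refine ⟨fun y => ?_, h.2⟩
  rw [State.setReg_reg]
  split_ifs
  exacts [hv, h.1 y]

theorem State.Bounded.setArr {W : ℕ} {s : State} (h : s.Bounded W) (a : Arr) (i : ℕ) {v : ℕ}
    (hv : v ≤ W) : (s.setArr a i v).Bounded W := by
  refine ⟨h.1, fun b j => ?_⟩
  rw [State.setArr_arr]
  split_ifs
  · rw [Function.update_apply]
    split_ifs
    exacts [hv, h.2 a j]
  · exact h.2 b j

/-- Arithmetic expressions. -/
inductive Expr
  | var (x : Var)
  | lit (n : ℕ)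
  | op (o : RAM.Op) (a b : Expr)
  | mod (a b : Expr)
  | get (a : Arr) (b : Expr)

namespace Expr

instance : Add Expr := ⟨Expr.op .add⟩
instance : Sub Expr := ⟨Expr.op .sub⟩
instance : Mul Expr := ⟨Expr.op .mul⟩
instance : Div Expr := ⟨Expr.op .div⟩
instance : Mod Expr := ⟨Expr.mod⟩

/-- The value of an expression. -/
def eval (s : State) : Expr → ℕ
  | var x => s.reg x
  | lit n => n
  | op o a b => o.eval (a.eval s) (b.eval s)
  | mod a b => a.eval s % b.eval s
  | get a b => s.arr a (b.eval s)

/-- The operations that can increase their arguments do not exceed `W`. -/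
def Ok (W : ℕ) (s : State) : Expr → Prop
  | var _ => True
  | lit n => n ≤ W
  | op .add a b => a.Ok W s ∧ b.Ok W s ∧ a.eval s + b.eval s ≤ W
  | op .mul a b => a.Ok W s ∧ b.Ok W s ∧ a.eval s * b.eval s ≤ W
  | op .sub a b => a.Ok W s ∧ b.Ok W s
  | op .div a b => a.Ok W s ∧ b.Ok W s
  | mod a b => a.Ok W s ∧ b.Ok W s
  | get _ b => b.Ok W s

/-- The number of elementary steps. -/
def cost : Expr → ℕ
  | var _ => 2
  | lit _ => 1
  | op _ a b => a.cost + (b.cost + 1)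
  | mod a b => a.cost + (b.cost + (1 + (1 + 1)))
  | get _ b => b.cost + 1

section
variable (s : State) (W : ℕ) (a b : Expr)

@[simp] theorem eval_var (x : Var) : (var x).eval s = s.reg x := rfl
@[simp] theorem eval_lit (n : ℕ) : (lit n).eval s = n := rfl
@[simp] theorem eval_add : (a + b).eval s = a.eval s + b.eval s := rfl
@[simp] theorem eval_sub : (a - b).eval s = a.eval s - b.eval s := rfl
@[simp] theorem eval_mul : (a * b).eval s = a.eval s * b.eval s := rfl
@[simp] theorem eval_div : (a / b).eval s = a.eval s / b.eval s := rfl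
@[simp] theorem eval_mod : (a % b).eval s = a.eval s % b.eval s := rfl
@[simp] theorem eval_get (c : Arr) : (get c a).eval s = s.arr c (a.eval s) := rfl

@[simp] theorem ok_var (x : Var) : (var x).Ok W s := trivial
@[simp] theorem ok_lit (n : ℕ) : (lit n).Ok W s ↔ n ≤ W := Iff.rfl
@[simp] theorem ok_add : (a + b).Ok W s ↔ a.Ok W s ∧ b.Ok W s ∧ a.eval s + b.eval s ≤ W := Iff.rfl
@[simp] theorem ok_sub : (a - b).Ok W s ↔ a.Ok W s ∧ b.Ok W s := Iff.rfl
@[simp] theorem ok_mul : (a * b).Ok W s ↔ a.Ok W s ∧ b.Ok W s ∧ a.eval s * b.eval s ≤ W := Iff.rfl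
@[simp] theorem ok_div : (a / b).Ok W s ↔ a.Ok W s ∧ b.Ok W s := Iff.rfl
@[simp] theorem ok_mod : (a % b).Ok W s ↔ a.Ok W s ∧ b.Ok W s := Iff.rfl
@[simp] theorem ok_get (c : Arr) : (get c a).Ok W s ↔ a.Ok W s := Iff.rfl

@[simp] theorem cost_var (x : Var) : (var x).cost = 2 := rfl
@[simp] theorem cost_lit (n : ℕ) : (lit n).cost = 1 := rfl
@[simp] theorem cost_add : (a + b).cost = a.cost + (b.cost + 1) := rfl
@[simp] theorem cost_sub : (a - b).cost = a.cost + (b.cost + 1) := rfl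
@[simp] theorem cost_mul : (a * b).cost = a.cost + (b.cost + 1) := rfl
@[simp] theorem cost_div : (a / b).cost = a.cost + (b.cost + 1) := rfl
@[simp] theorem cost_mod : (a % b).cost = a.cost + (b.cost + (1 + (1 + 1))) := rfl
@[simp] theorem cost_get (c : Arr) : (get c a).cost = a.cost + 1 := rfl

end

/-- The program that computes the value of an expression in register `24 + k`. -/
def compile : Expr → ℕ → RAM.Program
  | var x, k => .seq (.const (24 + k) 0) (.op .add (24 + k) x.toNat (24 + k))
  | lit n, k => .const (24 + k) n
  | op o a b, k =>
    .seq (a.compile k) (.seq (b.compile (k + 1)) (.op o (24 + k) (24 + k) (24 + (k + 1))))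
  | mod a b, k =>
    .seq (a.compile k) (.seq (b.compile (k + 1))
      (.seq (.op .div (24 + (k + 2)) (24 + k) (24 + (k + 1)))
        (.seq (.op .mul (24 + (k + 2)) (24 + (k + 2)) (24 + (k + 1)))
          (.op .sub (24 + k) (24 + k) (24 + (k + 2))))))
  | get a b, k => .seq (b.compile k) (.load (24 + k) a.toNat (24 + k))

end Expr

/-! ### Correctness of the compiler -/

/-- The machine contents `st` represent `s`. -/
structure Represents (st : RAM.Store) (s : State) : Prop where
  reg (x : Var) : st.reg x.toNat = s.reg x
  arr (a : Arr) : st.arr a.toNat = s.arr a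

theorem Represents.of_eq {st st' : RAM.Store} {s : State} (h : Represents st s)
    (hr : ∀ y < 24, st'.reg y = st.reg y) (ha : st'.arr = st.arr) : Represents st' s :=
  ⟨fun x => by rw [hr _ x.toNat_lt, h.reg], fun a => by rw [ha, h.arr]⟩

/-- The registers from `24` on serve as an evaluation stack. Nothing below `24 + k` is touched, so
the first operand survives the evaluation of the second. That the value is at most `W` is part of
the induction because subtraction, division and remainder carry no bound of their own in `Ok`. -/
theorem Expr.exec_compile {W : ℕ} {s : State} (hs : s.Bounded W) (e : Expr) (hok : e.Ok W s) (k : ℕ)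
    {st : RAM.Store} (hst : Represents st s) :
    ∃ st', RAM.Exec W (e.compile k) st e.cost st' ∧ st'.reg (24 + k) = e.eval s ∧ e.eval s ≤ W ∧
      (∀ y < 24 + k, st'.reg y = st.reg y) ∧ st'.arr = st.arr := by
  induction e generalizing k st with
  | var x =>
    have hne : x.toNat ≠ 24 + k := by have := x.toNat_lt; omega
    refine ⟨_, .seq (.const _ _ _ (Nat.zero_le _)) (.op _ _ _ _ _ ?_), ?_, hs.1 x, ?_, rfl⟩
    · simpa [RAM.Op.eval, RAM.Store.setReg, hne, hst.reg] using hs.1 x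
    · simp [RAM.Op.eval, RAM.Store.setReg, hne, hst.reg]
    · intro y hy
      simp [RAM.Store.setReg, Function.update_apply, hy.ne]
  | lit n =>
    refine ⟨_, .const _ _ _ hok, by simp [RAM.Store.setReg, eval], hok, ?_, rfl⟩
    intro y hy
    simp [RAM.Store.setReg, Function.update_apply, hy.ne]
  | op o a b iha ihb =>
    have ha : a.Ok W s := by cases o <;> exact hok.1
    have hb : b.Ok W s := by
      cases o
      exacts [hok.2.1, hok.2, hok.2.1, hok.2]
    obtain ⟨st1, he1, hv1, hW1, hr1, hA1⟩ := iha ha k hst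
    obtain ⟨st2, he2, hv2, hW2, hr2, hA2⟩ :=
      ihb hb (k + 1) (hst.of_eq (fun y hy => hr1 y (by omega)) hA1)
    have h1 : st2.reg (24 + k) = a.eval s := by rw [hr2 _ (by omega), hv1]
    have hW : o.eval (a.eval s) (b.eval s) ≤ W := by
      cases o
      · exact hok.2.2
      · exact (Nat.sub_le _ _).trans hW1
      · exact hok.2.2
      · exact (Nat.div_le_self _ _).trans hW1
    refine ⟨_, .seq he1 (.seq he2 (.op _ _ _ _ _ ?_)), ?_, hW, ?_, hA2.trans hA1⟩
    · rw [h1, hv2]; exact hW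
    · simp [RAM.Store.setReg, h1, hv2, eval]
    · intro y hy
      simp only [RAM.Store.setReg, Function.update_apply, hy.ne, if_false]
      rw [hr2 y (by omega), hr1 y hy]
  | mod a b iha ihb =>
    obtain ⟨st1, he1, hv1, hW1, hr1, hA1⟩ := iha hok.1 k hst
    obtain ⟨st2, he2, hv2, hW2, hr2, hA2⟩ :=
      ihb hok.2 (k + 1) (hst.of_eq (fun y hy => hr1 y (by omega)) hA1)
    have h1 : st2.reg (24 + k) = a.eval s := by rw [hr2 _ (by omega), hv1]
    have hW := (Nat.mod_le (a.eval s) (b.eval s)).trans hW1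
    -- Also valid for divisor `0`: the quotient is then `0` and the remainder is the dividend.
    have hsub : a.eval s - a.eval s / b.eval s * b.eval s = a.eval s % b.eval s := by
      rw [Nat.mod_eq_sub, mul_comm]
    refine ⟨_, .seq he1 (.seq he2 (.seq (.op _ _ _ _ _ ?_) (.seq (.op _ _ _ _ _ ?_)
      (.op _ _ _ _ _ ?_)))), ?_, hW, ?_, hA2.trans hA1⟩
    · rw [h1, hv2]; exact (Nat.div_le_self _ _).trans hW1
    · simp only [RAM.Store.setReg, RAM.Op.eval, Function.update_apply]
      simp only [h1, hv2, if_true]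
      simp only [show ¬ (24 + (k + 1) = 24 + (k + 2)) by omega, if_false, hv2]
      exact (Nat.div_mul_le_self _ _).trans hW1
    · simp [RAM.Store.setReg, RAM.Op.eval, Function.update_apply, h1, hv2, hsub]
      omega
    · simp [RAM.Store.setReg, RAM.Op.eval, Function.update_apply, h1, hv2, eval, hsub]
    · intro y hy
      simp only [RAM.Store.setReg, Function.update_apply, hy.ne, show y ≠ 24 + (k + 2) by omega,
        if_false]
      rw [hr2 y (by omega), hr1 y hy]
  | get a b ih =>
    obtain ⟨st1, he1, hv1, hW1, hr1, hA1⟩ := ih hok k hst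
    have h1 : st1.arr a.toNat (st1.reg (24 + k)) = s.arr a (b.eval s) := by
      rw [hv1, hA1, hst.arr]
    refine ⟨_, .seq he1 (.load _ _ _ _ ?_), ?_, hs.2 _ _, ?_, hA1⟩
    · rw [h1]; exact hs.2 _ _
    · simp [RAM.Store.setReg, h1, eval]
    · intro y hy
      simp only [RAM.Store.setReg, Function.update_apply, hy.ne, if_false]
      rw [hr1 y hy]

/-- Comparisons of expressions. -/
inductive Cond
  | lt (a b : Expr)
  | eq (a b : Expr)

namespace Cond

def Holds (s : State) : Cond → Prop
  | lt a b => a.eval s < b.eval s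
  | eq a b => a.eval s = b.eval s

def Ok (W : ℕ) (s : State) : Cond → Prop
  | lt a b => a.Ok W s ∧ b.Ok W s
  | eq a b => a.Ok W s ∧ b.Ok W s

def cost : Cond → ℕ
  | lt a b => a.cost + (b.cost + 1)
  | eq a b => a.cost + (b.cost + 1)

end Cond

/-- Commands. In `loop x n P`, the variable `x` runs from `0` to `n - 1`. -/
inductive Cmd
  | skip
  | assign (x : Var) (a : Expr)
  | put (c : Arr) (a b : Expr)
  | seq (P Q : Cmd)
  | ite (c : Cond) (P Q : Cmd)
  | loop (x n : Var) (P : Cmd)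

infixr:60 " ;; " => Cmd.seq

namespace Cmd

/-- The variables that a command may change. -/
def regs : Cmd → List Var
  | skip => []
  | assign x _ => [x]
  | put _ _ _ => []
  | seq P Q => P.regs ++ Q.regs
  | ite _ P Q => P.regs ++ Q.regs
  | loop x _ P => x :: P.regs

/-- The arrays that a command may change. -/
def arrs : Cmd → List Arr
  | skip => []
  | assign _ _ => []
  | put c _ _ => [c]
  | seq P Q => P.arrs ++ Q.arrs
  | ite _ P Q => P.arrs ++ Q.arrs
  | loop _ _ P => P.arrs

/-- The state before round `k` of a loop over `x` whose body acts as `f`. -/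
def iter (x : Var) (f : State → State) (s : State) : ℕ → State
  | 0 => s.setReg x 0
  | k + 1 => (f (iter x f s k)).setReg x (k + 1)

open Classical in
/-- The effect of a command. -/
noncomputable def run : Cmd → State → State
  | skip => fun s => s
  | assign x a => fun s => s.setReg x (a.eval s)
  | put c a b => fun s => s.setArr c (a.eval s) (b.eval s)
  | seq P Q => fun s => Q.run (P.run s)
  | ite c P Q => fun s => if c.Holds s then P.run s else Q.run s
  | loop x n P => fun s => iter x P.run s (s.reg n)

/-- No number exceeds `W`, and loops up to `n` have at most `β n` rounds. -/
def Ok (W : ℕ) (β : Var → ℕ) : Cmd → State → Prop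
  | skip => fun _ => True
  | assign _ a => fun s => a.Ok W s
  | put _ a b => fun s => a.Ok W s ∧ b.Ok W s
  | seq P Q => fun s => P.Ok W β s ∧ Q.Ok W β (P.run s)
  | ite c P Q => fun s => c.Ok W s ∧ (c.Holds s → P.Ok W β s) ∧ (¬ c.Holds s → Q.Ok W β s)
  | loop x n P => fun s => (x ≠ n ∧ x ∉ P.regs ∧ n ∉ P.regs) ∧ s.reg n ≤ β n ∧
      ∀ k < s.reg n, P.Ok W β (iter x P.run s k)

/-- A bound on the number of steps, if loops up to `n` have at most `β n` rounds. -/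
def cost (β : Var → ℕ) : Cmd → ℕ
  | skip => 1
  | assign _ a => a.cost + 2
  | put _ a b => a.cost + (b.cost + 1)
  | seq P Q => P.cost β + Q.cost β
  | ite c P Q => c.cost + (P.cost β + Q.cost β)
  | loop _ n P => β n * (P.cost β + 3) + 2

/-- The machine program of a command. -/
def compile : Cmd → RAM.Program
  | skip => .skip
  | assign x a => .seq (a.compile 0) (.seq (.const 25 0) (.op .add x.toNat 24 25))
  | put c a b => .seq (a.compile 0) (.seq (b.compile 1) (.store c.toNat 24 25))
  | seq P Q => .seq P.compile Q.compile
  | ite (.lt a b) P Q =>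
    .seq (a.compile 0) (.seq (b.compile 1) (.ite (.lt 24 25) P.compile Q.compile))
  | ite (.eq a b) P Q =>
    .seq (a.compile 0) (.seq (b.compile 1) (.ite (.eq 24 25) P.compile Q.compile))
  | loop x n P =>
    .seq (.const x.toNat 0) (.while (.lt x.toNat n.toNat)
      (.seq P.compile (.seq (.const 24 1) (.op .add x.toNat x.toNat 24))))

/-- The lists of written variables and arrays are syntactic, so that the invariance of everything
else can later be settled by `decide`. -/
theorem run_frame (P : Cmd) (s : State) :
    (∀ y ∉ P.regs, (P.run s).reg y = s.reg y) ∧ ∀ a ∉ P.arrs, (P.run s).arr a = s.arr a := by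
  induction P generalizing s with
  | skip => exact ⟨fun _ _ => rfl, fun _ _ => rfl⟩
  | assign x a =>
    refine ⟨fun y hy => ?_, fun _ _ => rfl⟩
    simp only [regs, List.mem_singleton] at hy
    simp [run, hy]
  | put c a b =>
    refine ⟨fun _ _ => rfl, fun d hd => ?_⟩
    simp only [arrs, List.mem_singleton] at hd
    simp [run, hd]
  | seq P Q ihP ihQ =>
    simp only [regs, arrs, List.mem_append, not_or, run]
    exact ⟨fun y hy => by rw [(ihQ _).1 y hy.2, (ihP _).1 y hy.1],
      fun y hy => by rw [(ihQ _).2 y hy.2, (ihP _).2 y hy.1]⟩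
  | ite c P Q ihP ihQ =>
    simp only [regs, arrs, List.mem_append, not_or, run]
    split_ifs
    · exact ⟨fun y hy => (ihP _).1 y hy.1, fun y hy => (ihP _).2 y hy.1⟩
    · exact ⟨fun y hy => (ihQ _).1 y hy.2, fun y hy => (ihQ _).2 y hy.2⟩
  | loop x n P ih =>
    simp only [regs, arrs, List.mem_cons, not_or, run]
    generalize s.reg n = k
    induction k with
    | zero => exact ⟨fun y hy => by simp [iter, hy.1], fun _ _ => rfl⟩
    | succ k ihk =>
      refine ⟨fun y hy => ?_, fun a ha => ?_⟩
      · simp only [iter, State.setReg_reg, hy.1, if_false]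
        rw [(ih _).1 y hy.2, ihk.1 y hy]
      · simp only [iter, State.setReg_arr]
        rw [(ih _).2 a ha, ihk.2 a ha]

theorem iter_frame (x : Var) (P : Cmd) (s : State) (k : ℕ) :
    (∀ y ∉ P.regs, y ≠ x → (iter x P.run s k).reg y = s.reg y) ∧
      (∀ a ∉ P.arrs, (iter x P.run s k).arr a = s.arr a) ∧ (iter x P.run s k).reg x = k := by
  induction k with
  | zero => exact ⟨fun y _ hx => by simp [iter, hx], fun _ _ => rfl, by simp [iter]⟩
  | succ k ih =>
    refine ⟨fun y hy hx => ?_, fun a ha => ?_, by simp [iter]⟩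
    · simp only [iter, State.setReg_reg, hx, if_false]
      rw [(run_frame P _).1 y hy, ih.1 y hy hx]
    · simp only [iter, State.setReg_arr]
      rw [(run_frame P _).2 a ha, ih.2.1 a ha]

end Cmd

theorem Represents.setReg {st : RAM.Store} {s : State} (h : Represents st s) (x : Var) (v : ℕ) :
    Represents (st.setReg x.toNat v) (s.setReg x v) := by
  refine ⟨fun y => ?_, h.arr⟩
  simp [RAM.Store.setReg, Function.update_apply, Var.toNat_injective.eq_iff, h.reg]

theorem Represents.setArr {st : RAM.Store} {s : State} (h : Represents st s) (a : Arr) (i v : ℕ) :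
    Represents (st.setArr a.toNat i v) (s.setArr a i v) := by
  refine ⟨h.reg, fun b => ?_⟩
  simp [RAM.Store.setArr, Function.update_apply, Arr.toNat_injective.eq_iff, h.arr]

theorem Represents.setReg_of_le {st : RAM.Store} {s : State} (h : Represents st s) {y : ℕ}
    (hy : 24 ≤ y) (v : ℕ) : Represents (st.setReg y v) s :=
  h.of_eq (fun z hz => by simp [RAM.Store.setReg, Function.update_apply, (hz.trans_le hy).ne]) rfl

theorem Expr.exec_compile_two {W : ℕ} {s : State} (hs : s.Bounded W) (a b : Expr) (ha : a.Ok W s)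
    (hb : b.Ok W s) {st : RAM.Store} (hst : Represents st s) :
    ∃ st' st'', RAM.Exec W (a.compile 0) st a.cost st' ∧ RAM.Exec W (b.compile 1) st' b.cost st'' ∧
      st''.reg 24 = a.eval s ∧ st''.reg 25 = b.eval s ∧ b.eval s ≤ W ∧ Represents st'' s := by
  obtain ⟨st1, he1, hv1, hW1, hr1, hA1⟩ := a.exec_compile hs ha 0 hst
  have h1 := hst.of_eq hr1 hA1
  obtain ⟨st2, he2, hv2, hW2, hr2, hA2⟩ := b.exec_compile hs hb 1 h1
  refine ⟨st1, st2, he1, he2, ?_, hv2, hW2, h1.of_eq (fun y hy => hr2 y (by omega)) hA2⟩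
  rw [hr2 _ (by omega), hv1]

/-- The compiled program simulates the command. -/
theorem Cmd.exec_compile {W : ℕ} {β : Var → ℕ} (hW : 1 ≤ W) (P : Cmd) {s : State}
    (hs : s.Bounded W) (hok : P.Ok W β s) {st : RAM.Store} (hst : Represents st s) :
    ∃ t st', RAM.Exec W P.compile st t st' ∧ t ≤ P.cost β ∧ Represents st' (P.run s) ∧
      (P.run s).Bounded W := by
  induction P generalizing s st with
  | skip => exact ⟨1, st, .skip _, le_rfl, hst, hs⟩
  | assign x a =>
    obtain ⟨st1, he1, hv1, hW1, hr1, hA1⟩ := a.exec_compile hs hok 0 hst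
    have hv : ((st1.setReg 25 0).reg 24) + ((st1.setReg 25 0).reg 25) = a.eval s := by
      simpa [RAM.Store.setReg, Function.update_apply] using hv1
    refine ⟨_, _, .seq he1 (.seq (.const _ _ _ (Nat.zero_le _)) (.op _ _ _ _ _ ?_)), le_rfl, ?_,
      hs.setReg x hW1⟩
    · simp only [RAM.Op.eval]
      rw [hv]; exact hW1
    · simp only [RAM.Op.eval]
      rw [hv]
      exact ((hst.of_eq hr1 hA1).setReg_of_le (by norm_num) 0).setReg x _
  | put c a b =>
    obtain ⟨st1, st2, he1, he2, h1, h2, h3, h4⟩ := a.exec_compile_two hs b hok.1 hok.2 hst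
    refine ⟨_, _, .seq he1 (.seq he2 (.store _ _ _ _ (h2 ▸ h3))), le_rfl, ?_, hs.setArr c _ h3⟩
    rw [h1, h2]
    exact h4.setArr _ _ _
  | seq P Q ihP ihQ =>
    obtain ⟨t1, st1, he1, ht1, hr1, hb1⟩ := ihP hs hok.1 hst
    obtain ⟨t2, st2, he2, ht2, hr2, hb2⟩ := ihQ hb1 hok.2 hr1
    exact ⟨_, _, .seq he1 he2, Nat.add_le_add ht1 ht2, hr2, hb2⟩
  | ite c P Q ihP ihQ =>
    obtain ⟨hc, hP, hQ⟩ := hok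
    by_cases h : c.Holds s
    · cases c with
      | lt a b =>
        obtain ⟨st1, st2, he1, he2, h1, h2, h3, h4⟩ := a.exec_compile_two hs b hc.1 hc.2 hst
        obtain ⟨t, st', he, ht, hr, hb⟩ := ihP hs (hP h) h4
        have hh : (RAM.Test.lt 24 25).holds st2 := by
          simp only [RAM.Test.holds, h1, h2]; exact h
        refine ⟨_, _, .seq he1 (.seq he2 (.iteTrue hh he)), ?_, ?_, ?_⟩
        · simp only [cost, Cond.cost]; omega
        · simpa [run, h] using hr
        · simpa [run, h] using hb
      | eq a b =>
        obtain ⟨st1, st2, he1, he2, h1, h2, h3, h4⟩ := a.exec_compile_two hs b hc.1 hc.2 hst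
        obtain ⟨t, st', he, ht, hr, hb⟩ := ihP hs (hP h) h4
        have hh : (RAM.Test.eq 24 25).holds st2 := by
          simp only [RAM.Test.holds, h1, h2]; exact h
        refine ⟨_, _, .seq he1 (.seq he2 (.iteTrue hh he)), ?_, ?_, ?_⟩
        · simp only [cost, Cond.cost]; omega
        · simpa [run, h] using hr
        · simpa [run, h] using hb
    · cases c with
      | lt a b =>
        obtain ⟨st1, st2, he1, he2, h1, h2, h3, h4⟩ := a.exec_compile_two hs b hc.1 hc.2 hst
        obtain ⟨t, st', he, ht, hr, hb⟩ := ihQ hs (hQ h) h4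
        have hh : ¬ (RAM.Test.lt 24 25).holds st2 := by
          simp only [RAM.Test.holds, h1, h2]; exact h
        refine ⟨_, _, .seq he1 (.seq he2 (.iteFalse hh he)), ?_, ?_, ?_⟩
        · simp only [cost, Cond.cost]; omega
        · simpa [run, h] using hr
        · simpa [run, h] using hb
      | eq a b =>
        obtain ⟨st1, st2, he1, he2, h1, h2, h3, h4⟩ := a.exec_compile_two hs b hc.1 hc.2 hst
        obtain ⟨t, st', he, ht, hr, hb⟩ := ihQ hs (hQ h) h4
        have hh : ¬ (RAM.Test.eq 24 25).holds st2 := by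
          simp only [RAM.Test.holds, h1, h2]; exact h
        refine ⟨_, _, .seq he1 (.seq he2 (.iteFalse hh he)), ?_, ?_, ?_⟩
        · simp only [cost, Cond.cost]; omega
        · simpa [run, h] using hr
        · simpa [run, h] using hb
  | loop x n P ih =>
    obtain ⟨⟨hxn, hx, hn⟩, hβ, hbody⟩ := hok
    -- Induction on the number `l` of remaining rounds. A round costs three steps besides the body
    -- (test, constant, increment); the extra `1` is the final failing test.
    have key : ∀ l k st, k + l = s.reg n → Represents st (iter x P.run s k) →
        (iter x P.run s k).Bounded W →
        ∃ t st', RAM.Exec W (.while (.lt x.toNat n.toNat)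
          (.seq P.compile (.seq (.const 24 1) (.op .add x.toNat x.toNat 24)))) st t st' ∧
          t ≤ l * (P.cost β + 3) + 1 ∧ Represents st' (iter x P.run s (s.reg n)) ∧
          (iter x P.run s (s.reg n)).Bounded W := by
      intro l
      induction l with
      | zero =>
        intro k st hk hr hb
        obtain rfl : k = s.reg n := by omega
        obtain ⟨f1, -, f3⟩ := iter_frame x P s (s.reg n)
        refine ⟨1, st, .whileFalse ?_, by omega, hr, hb⟩
        simp only [RAM.Test.holds, hr.reg, f3, f1 n hn hxn.symm, lt_irrefl, not_false_eq_true]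
      | succ l ihl =>
        intro k st hk hr hb
        obtain ⟨f1, -, f3⟩ := iter_frame x P s k
        obtain ⟨t1, st1, he1, ht1, hr1, hb1⟩ := ih hb (hbody k (by omega)) hr
        have hx1 : (P.run (iter x P.run s k)).reg x = k := by rw [(run_frame P _).1 x hx, f3]
        have hkW : k + 1 ≤ W := by
          have := hs.1 n
          omega
        have hv : ((st1.setReg 24 1).reg x.toNat) + ((st1.setReg 24 1).reg 24) = k + 1 := by
          simp [RAM.Store.setReg, Function.update_apply, x.toNat_lt.ne, hr1.reg, hx1]
        have hr2 : Represents ((st1.setReg 24 1).setReg x.toNat (k + 1)) (iter x P.run s (k + 1)) :=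
          (hr1.setReg_of_le le_rfl 1).setReg x _
        obtain ⟨t2, st2, he2, ht2, hr3, hb3⟩ := ihl (k + 1) _ (by omega) hr2 (hb1.setReg x hkW)
        refine ⟨1 + (t1 + (1 + 1)) + t2, st2, .whileTrue ?_ (.seq he1 (.seq (.const _ _ _ hW) (.op _ _ _ _ _ ?_))) ?_,
          ?_, hr3, hb3⟩
        · simp only [RAM.Test.holds, hr.reg, f3, f1 n hn hxn.symm]
          omega
        · simp only [RAM.Op.eval]; rw [hv]; exact hkW
        · simp only [RAM.Op.eval]; rw [hv]; exact he2
        · rw [Nat.succ_mul]; omega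
    obtain ⟨t, st', he, ht, hr, hb⟩ := key (s.reg n) 0 (st.setReg x.toNat 0) (by omega)
      (hst.setReg x 0) (hs.setReg x (Nat.zero_le _))
    refine ⟨_, st', .seq (.const _ _ _ (Nat.zero_le _)) he, ?_, hr, hb⟩
    have := Nat.mul_le_mul_right (P.cost β + 3) hβ
    simp only [cost]
    omega

/-! ### Specifications of commands -/

/-- The command respects the bounds and establishes `R`. -/
def Spec (W : ℕ) (β : Var → ℕ) (P : Cmd) (s : State) (R : State → Prop) : Prop :=
  P.Ok W β s ∧ R (P.run s)

section
variable {W : ℕ} {β : Var → ℕ} {s : State} {R : State → Prop}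

/-- This and the following equivalences compute weakest preconditions, so that `simp` can execute
loop-free code symbolically. -/
theorem spec_skip : Spec W β .skip s R ↔ R s := by simp [Spec, Cmd.Ok, Cmd.run]

theorem spec_assign {x : Var} {a : Expr} :
    Spec W β (.assign x a) s R ↔ a.Ok W s ∧ R (s.setReg x (a.eval s)) := Iff.rfl

theorem spec_put {c : Arr} {a b : Expr} :
    Spec W β (.put c a b) s R ↔
      a.Ok W s ∧ b.Ok W s ∧ R (s.setArr c (a.eval s) (b.eval s)) := and_assoc

theorem spec_seq {P Q : Cmd} :
    Spec W β (P ;; Q) s R ↔ Spec W β P s (fun s' => Spec W β Q s' R) := and_assoc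

theorem spec_ite_lt {a b : Expr} {P Q : Cmd} :
    Spec W β (.ite (.lt a b) P Q) s R ↔ a.Ok W s ∧ b.Ok W s ∧
      (a.eval s < b.eval s → Spec W β P s R) ∧ (¬ a.eval s < b.eval s → Spec W β Q s R) := by
  by_cases h : a.eval s < b.eval s <;>
    simp [Spec, Cmd.Ok, Cmd.run, Cond.Ok, Cond.Holds, h, and_assoc]

theorem spec_ite_eq {a b : Expr} {P Q : Cmd} :
    Spec W β (.ite (.eq a b) P Q) s R ↔ a.Ok W s ∧ b.Ok W s ∧
      (a.eval s = b.eval s → Spec W β P s R) ∧ (¬ a.eval s = b.eval s → Spec W β Q s R) := by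
  by_cases h : a.eval s = b.eval s <;>
    simp [Spec, Cmd.Ok, Cmd.run, Cond.Ok, Cond.Holds, h, and_assoc]

/-- Besides weakening the postcondition, this supplies that everything not written by `P` is
unchanged. -/
theorem Spec.mono {P : Cmd} {R' : State → Prop} (h : Spec W β P s R)
    (hR : ∀ s', (∀ y ∉ P.regs, s'.reg y = s.reg y) → (∀ a ∉ P.arrs, s'.arr a = s.arr a) → R s' →
      R' s') : Spec W β P s R' :=
  ⟨h.1, hR _ (P.run_frame s).1 (P.run_frame s).2 h.2⟩

/-- The invariant rule. The body's postcondition speaks of `s''.setReg x (k + 1)` because the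
counter is advanced outside the body. -/
theorem Spec.loop {x n : Var} {P : Cmd} (I : ℕ → State → Prop)
    (hwf : x ≠ n ∧ x ∉ P.regs ∧ n ∉ P.regs) (hβ : s.reg n ≤ β n) (h0 : I 0 (s.setReg x 0))
    (hstep : ∀ k s', k < s.reg n → (∀ y ∉ P.regs, y ≠ x → s'.reg y = s.reg y) →
      (∀ a ∉ P.arrs, s'.arr a = s.arr a) → s'.reg x = k → I k s' →
      Spec W β P s' (fun s'' => I (k + 1) (s''.setReg x (k + 1))))
    (hR : ∀ s', I (s.reg n) s' → R s') : Spec W β (.loop x n P) s R := by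
  have h1 : ∀ k ≤ s.reg n, I k (Cmd.iter x P.run s k) := by
    intro k
    induction k with
    | zero => exact fun _ => h0
    | succ k ih =>
      intro hk
      obtain ⟨f1, f2, f3⟩ := Cmd.iter_frame x P s k
      exact (hstep k _ hk f1 f2 f3 (ih (by omega))).2
  refine ⟨⟨hwf, hβ, fun k hk => ?_⟩, hR _ (h1 _ le_rfl)⟩
  obtain ⟨f1, f2, f3⟩ := Cmd.iter_frame x P s k
  exact (hstep k _ hk f1 f2 f3 (h1 k hk.le)).1

end

/-! ### Reading the input and marking the reachable states -/

/-- The machine is loaded with the automaton `A`. -/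
structure Loaded {p N : ℕ} (A : DFA (Fin (2 ^ p)) (Fin N)) (s : State) : Prop where
  card : s.reg .N = N
  base : s.reg .base = 2 ^ p
  start : s.reg .start = A.start
  delta (q : Fin N) (d : Fin (2 ^ p)) : s.arr .delta (q * 2 ^ p + d) = A.step q d

/-- The bounds that all phases of the algorithm need. -/
structure Bounds (p N W : ℕ) (β : Var → ℕ) : Prop where
  le : 4 * ((2 ^ p) ^ 2 * N ^ 2) ≤ W
  card_pos : 1 ≤ N
  p_pos : 1 ≤ p
  β_N : β .N = N
  β_p : β .p = p
  β_base : β .base = 2 ^ p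
  β_lim : β .lim = 4 * (2 ^ p * N)
  β_size : β .size = 3 * (2 ^ p * N ^ 2)

theorem Bounds.two_le {p N W : ℕ} {β : Var → ℕ} (h : Bounds p N W β) : 2 ≤ 2 ^ p :=
  Nat.one_lt_two_pow (by have := h.p_pos; omega)

theorem Bounds.four_mul_le {p N W : ℕ} {β : Var → ℕ} (h : Bounds p N W β) :
    4 * (2 ^ p * N) ≤ W := by
  refine le_trans ?_ h.le
  rw [← mul_pow]
  exact Nat.mul_le_mul_left _ (Nat.le_self_pow (by norm_num) _)

theorem Bounds.mul_le {p N W : ℕ} {β : Var → ℕ} (h : Bounds p N W β) : N * 2 ^ p ≤ W := by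
  have := h.four_mul_le
  rw [mul_comm N]
  omega

theorem Bounds.base_le {p N W : ℕ} {β : Var → ℕ} (h : Bounds p N W β) : 4 * 2 ^ p ≤ W :=
  le_trans (by have := h.card_pos; nlinarith [h.two_le]) h.four_mul_le

theorem Bounds.N_le {p N W : ℕ} {β : Var → ℕ} (h : Bounds p N W β) : N ≤ W :=
  le_trans (by have := h.card_pos; nlinarith [h.two_le]) h.four_mul_le

theorem mul_add_lt_mul {a b q d : ℕ} (hq : q < a) (hd : d < b) : q * b + d < a * b := by
  have : (q + 1) * b ≤ a * b := Nat.mul_le_mul_right _ hq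
  rw [Nat.succ_mul] at this
  omega

/-- Sets `base` to `2 ^ p`. -/
def computeBase : Cmd :=
  .assign .base (.lit 1) ;; .loop .i .p (.assign .base (.var .base + .var .base))

theorem spec_computeBase {p N W : ℕ} {β : Var → ℕ} (hB : Bounds p N W β) {s : State}
    (hp : s.reg .p = p) : Spec W β computeBase s (fun s' => s'.reg .base = 2 ^ p) := by
  have hW := hB.base_le
  have h2 := hB.two_le
  simp only [computeBase, spec_seq, spec_assign, Expr.ok_lit]
  refine ⟨by omega, Spec.loop (fun k s => s.reg .base = 2 ^ k) (by decide) ?_ ?_ ?_ ?_⟩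
  · simp [hp, hB.β_p]
  · simp
  · intro k s' hk _ _ _ hI
    simp [hp] at hk
    have : 2 ^ k ≤ 2 ^ p := Nat.pow_le_pow_right (by norm_num) hk.le
    simp [spec_assign, hI]
    exact ⟨by omega, by ring⟩
  · intro s' h
    simpa [hp] using h

/-- Marks the reachable states. -/
def markReachable : Cmd :=
  .put .reach (.var .start) (.lit 1) ;;
  .loop .i .N (.loop .q .N (.ite (.eq (.get .reach (.var .q)) (.lit 1))
    (.loop .d .base (.put .reach (.get .delta (.var .q * .var .base + .var .d)) (.lit 1))) .skip))

section
variable {p N W : ℕ} {β : Var → ℕ} {A : DFA (Fin (2 ^ p)) (Fin N)} {s : State}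

theorem Loaded.frame (h : Loaded A s) {s' : State} (hN : s'.reg .N = s.reg .N)
    (hb : s'.reg .base = s.reg .base) (hs : s'.reg .start = s.reg .start)
    (hd : s'.arr .delta = s.arr .delta) : Loaded A s' :=
  ⟨hN ▸ h.card, hb ▸ h.base, hs ▸ h.start, fun q d => by rw [hd]; exact h.delta q d⟩

theorem Loaded.frame_regs (h : Loaded A s) {s' : State} (P : Cmd)
    (hr : ∀ y ∉ P.regs, s'.reg y = s.reg y) (ha : ∀ a ∉ P.arrs, s'.arr a = s.arr a)
    (hN : .N ∉ P.regs := by decide) (hb : .base ∉ P.regs := by decide)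
    (hs : .start ∉ P.regs := by decide) (hd : .delta ∉ P.arrs := by decide) : Loaded A s' :=
  h.frame (hr _ hN) (hr _ hb) (hr _ hs) (ha _ hd)

theorem Loaded.frame_loop (h : Loaded A s) {s' : State} (P : Cmd) (x : Var)
    (hr : ∀ y ∉ P.regs, y ≠ x → s'.reg y = s.reg y) (ha : ∀ a ∉ P.arrs, s'.arr a = s.arr a)
    (hN : .N ∉ P.regs ∧ .N ≠ x := by decide) (hb : .base ∉ P.regs ∧ .base ≠ x := by decide)
    (hs : .start ∉ P.regs ∧ .start ≠ x := by decide) (hd : .delta ∉ P.arrs := by decide) :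
    Loaded A s' :=
  h.frame (hr _ hN.1 hN.2) (hr _ hb.1 hb.2) (hr _ hs.1 hs.2) (ha _ hd)

/-- Only reachable states are marked, and the states in `S` are. -/
def Marks (A : DFA (Fin (2 ^ p)) (Fin N)) (f : ℕ → ℕ) (S : Set (Fin N)) : Prop :=
  (∀ q : Fin N, f q = 1 → ∃ w, A.eval w = q) ∧ ∀ q ∈ S, f q = 1

theorem Marks.update {f : ℕ → ℕ} {S : Set (Fin N)} (h : Marks A f S) (t : Fin N)
    (ht : ∃ w, A.eval w = t) : Marks A (Function.update f t 1) (insert t S) := by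
  constructor
  · intro q hq
    by_cases hqt : q = t
    · rwa [hqt]
    · rw [Function.update_of_ne (fun h => hqt (Fin.ext h))] at hq
      exact h.1 q hq
  · rintro q (rfl | hq)
    · simp
    · by_cases hqt : q = t
      · simp [hqt]
      · rw [Function.update_of_ne (fun h => hqt (Fin.ext h))]
        exact h.2 q hq

theorem Marks.mono {f : ℕ → ℕ} {S S' : Set (Fin N)} (h : Marks A f S) (hS : S' ⊆ S) :
    Marks A f S' := ⟨h.1, fun q hq => h.2 q (hS hq)⟩

/-- Every reachable state is reached by a word shorter than the number of states. -/
theorem exists_short_word (A : DFA (Fin (2 ^ p)) (Fin N)) (w : List (Fin (2 ^ p))) :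
    ∃ v : List (Fin (2 ^ p)), v.length ≤ N ∧ A.eval v = A.eval w := by
  induction h : w.length using Nat.strong_induction_on generalizing w with
  | _ n ih =>
    by_cases hn : w.length ≤ N
    · exact ⟨w, hn, rfl⟩
    -- A word longer than the number of states runs through a cycle `b`, which is cut out.
    · obtain ⟨q, a, b, c, hw, -, hb, hqa, hqb, hqc⟩ :=
        A.evalFrom_split (x := w) (s := A.start) (by simp; omega) rfl
      have hlen : (a ++ c).length < n := by
        have : 0 < b.length := List.length_pos_iff.2 hb
        rw [← h, hw]
        simp
        omega
      obtain ⟨v, hv, he⟩ := ih _ hlen (a ++ c) rfl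
      refine ⟨v, hv, he.trans ?_⟩
      rw [DFA.eval, DFA.evalFrom_of_append, hqa, hqc]

/-- Each pass over the states extends the admissible word length by one, and length `N` suffices.
The invariant bounds the marked set only from below by length, because a state marked during a pass
may already be used in that pass. -/
theorem spec_markReachable (hB : Bounds p N W β) (hL : Loaded A s) (h0 : ∀ j, s.arr .reach j = 0) :
    Spec W β markReachable s
      (fun s' => ∀ q : Fin N, s'.arr .reach q = 1 ↔ ∃ w, A.eval w = q) := by
  have hW := hB.base_le
  have h2 := hB.two_le
  have hNb := hB.mul_le
  simp only [markReachable, spec_seq, spec_put, Expr.ok_lit, Expr.ok_var]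
  refine ⟨trivial, by omega, ?_⟩
  have hL0 : Loaded A (s.setArr .reach (Expr.eval s (.var .start)) (Expr.eval s (.lit 1))) :=
    hL.frame rfl rfl rfl (by simp)
  have hM0 : Marks A (Function.update (s.arr .reach) A.start 1) {A.start} := by
    have : Marks A (s.arr .reach) ∅ := ⟨fun q hq => by simp [h0] at hq, by simp⟩
    simpa using this.update A.start ⟨[], rfl⟩
  refine Spec.loop (fun k s => Marks A (s.arr .reach) {q | ∃ w, w.length ≤ k ∧ A.eval w = q})
    (by decide) ?_ ?_ ?_ ?_
  · simp [hL.card, hB.β_N]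
  · refine Marks.mono (S := {A.start}) (by simpa [hL.start] using hM0) ?_
    rintro q ⟨w, hw, rfl⟩
    rw [List.eq_nil_of_length_eq_zero (by omega : w.length = 0)]
    rfl
  · intro k s1 hk hf ha _ hM
    have hL1 := hL0.frame_loop _ _ hf ha
    -- Second part: the successors of those states of number below `l` that are reached by words of
    -- length at most `k`.
    refine Spec.loop (fun l s => Marks A (s.arr .reach) ({q | ∃ w, w.length ≤ k ∧ A.eval w = q} ∪
      {q | ∃ w d, w.length ≤ k ∧ (A.eval w : ℕ) < l ∧ A.step (A.eval w) d = q}))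
      (by decide) ?_ ?_ ?_ ?_
    · simp [hL1.card, hB.β_N]
    · exact Marks.mono hM (by simp)
    · intro l s2 hl hf ha hq hM2
      have hL2 := hL1.frame_loop _ _ hf ha
      rw [hL1.card] at hl
      simp only [spec_ite_eq, Expr.ok_get, Expr.ok_var, Expr.ok_lit, Expr.eval_get, Expr.eval_var,
        Expr.eval_lit, spec_skip, hq, State.setReg_arr]
      refine ⟨trivial, by omega, ?_, ?_⟩
      · intro hmark
        have hreach := hM2.1 ⟨l, hl⟩ hmark
        refine Spec.loop (fun e s => Marks A (s.arr .reach)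
          ({q | ∃ w, w.length ≤ k ∧ A.eval w = q} ∪
          {q | ∃ w d, w.length ≤ k ∧ (A.eval w : ℕ) < l ∧ A.step (A.eval w) d = q} ∪
          {q | ∃ d : Fin (2 ^ p), (d : ℕ) < e ∧ A.step ⟨l, hl⟩ d = q}))
          (by decide) ?_ ?_ ?_ ?_
        · simp [hL2.base, hB.β_base]
        · refine Marks.mono hM2 ?_
          simp
        · intro e s3 he hf ha hd hM3
          have hL3 := hL2.frame_loop _ _ hf ha
          have hq3 := (hf .q (by decide) (by decide)).trans hq
          rw [hL2.base] at he
          have hlt := mul_add_lt_mul hl he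
          simp only [spec_put, Expr.ok_get, Expr.ok_add, Expr.ok_mul, Expr.ok_var, Expr.ok_lit,
            Expr.eval_get, Expr.eval_add, Expr.eval_mul, Expr.eval_var, Expr.eval_lit, hq3, hd,
            hL3.base, State.setReg_arr, State.setArr_arr, if_true]
          refine ⟨⟨⟨trivial, trivial, by omega⟩, trivial, by omega⟩, by omega, ?_⟩
          have hdelta := hL3.delta ⟨l, hl⟩ ⟨e, he⟩
          simp only at hdelta
          rw [hdelta]
          refine (hM3.update (A.step ⟨l, hl⟩ ⟨e, he⟩) ?_).mono ?_
          · obtain ⟨w, hw⟩ := hreach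
            exact ⟨w ++ [⟨e, he⟩], by rw [DFA.eval_append_singleton, hw]⟩
          · rintro q (hq | ⟨d, hd, rfl⟩)
            · exact .inr (.inl hq)
            · rcases Nat.lt_succ_iff_lt_or_eq.1 hd with hd | hd
              · exact .inr (.inr ⟨d, hd, rfl⟩)
              · left
                rw [show d = ⟨e, he⟩ from Fin.ext hd]
        · intro s3 hM3
          simp only [hL2.base] at hM3
          refine hM3.mono ?_
          rintro q (hq | ⟨w, d, hw, hlt, rfl⟩)
          · exact .inl (.inl hq)
          · rcases Nat.lt_succ_iff_lt_or_eq.1 hlt with hd | hd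
            · exact .inl (.inr ⟨w, d, hw, hd, rfl⟩)
            · refine .inr ⟨d, d.2, ?_⟩
              rw [show A.eval w = ⟨l, hl⟩ from Fin.ext hd]
      · intro hmark
        refine hM2.mono ?_
        rintro q (hq | ⟨w, d, hw, hlt, rfl⟩)
        · exact .inl hq
        · rcases Nat.lt_succ_iff_lt_or_eq.1 hlt with hd | hd
          · exact .inr ⟨w, d, hw, hd, rfl⟩
          · exact absurd (hd ▸ hM2.2 _ (.inl ⟨w, hw, rfl⟩)) hmark
    · intro s2 hM2
      simp only [State.setReg_arr]
      refine hM2.mono ?_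
      rintro q ⟨w, hw, rfl⟩
      rcases List.eq_nil_or_concat' w with rfl | ⟨v, d, rfl⟩
      · exact .inl ⟨[], by simp, rfl⟩
      · refine .inr ⟨v, d, by simpa using hw, ?_, ?_⟩
        · rw [hL1.card]; exact (A.eval v).2
        · rw [DFA.eval_append_singleton]
  · intro s1 hM q
    refine ⟨hM.1 q, ?_⟩
    rintro ⟨w, rfl⟩
    obtain ⟨v, hv, he⟩ := exists_short_word A w
    rw [← he]
    exact hM.2 _ ⟨v, by rw [State.setArr_reg, hL.card]; exact hv, rfl⟩

end

/-! ### Removing common last digits -/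

/-- `Y` is of the form `m T + r` with `0 ≤ r < m`. -/
def IsAffine (Y : Set ℕ) : Prop := ∃ m r : ℕ, r < m ∧ Y = thueMorseAffine m r

/-- The elements of `Y` with last digit `d` in base `b`, with this digit removed. -/
def digitQuotient (b d : ℕ) (Y : Set ℕ) : Set ℕ := {n | n * b + d ∈ Y}

/-- All elements of `Y` have the last digit `d` in base `b`, and there are such elements. -/
def UniqueDigit (b d : ℕ) (Y : Set ℕ) : Prop :=
  ∀ c < b, (∃ n, n * b + c ∈ Y) ↔ c = d

theorem digitQuotient_affine {b m r : ℕ} (hb : 0 < b) (h : r < m * b) :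
    digitQuotient b (r % b) (thueMorseAffine (m * b) r) = thueMorseAffine m (r / b) := by
  ext n
  have := mul_add_mem_thueMorseAffine_mul hb h n (r % b) (Nat.mod_lt _ hb)
  simpa [digitQuotient] using this

theorem uniqueDigit_affine {b m r : ℕ} (hb : 0 < b) (h : r < m * b) :
    UniqueDigit b (r % b) (thueMorseAffine (m * b) r) := by
  intro c hc
  constructor
  · rintro ⟨n, hn⟩
    exact ((mul_add_mem_thueMorseAffine_mul hb h n c hc).1 hn).1
  · rintro rfl
    refine ⟨r / b, ?_⟩
    rw [Nat.div_add_mod']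
    have := (mul_add_mem_thueMorseAffine_iff h 0).2 tmBit_zero
    simpa using this

theorem UniqueDigit.dvd {b d m r : ℕ} (hb : 0 < b) (hb3 : b.Coprime 3) (h : r < m)
    (hu : UniqueDigit b d (thueMorseAffine m r)) : b ∣ m := by
  by_contra hm
  refine add_mul_mod_ne (r := r) hb3 hm ?_
  have key : ∀ x ∈ thueMorseAffine m r, x % b = d := fun x hx =>
    (hu (x % b) (Nat.mod_lt _ hb)).1 ⟨x / b, by rwa [Nat.div_add_mod']⟩
  have h0 := (mul_add_mem_thueMorseAffine_iff h 0).2 tmBit_zero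
  have h3 := (mul_add_mem_thueMorseAffine_iff h 3).2 tmBit_three
  rw [key r (by simpa using h0), key (r + 3 * m) (by rwa [add_comm, mul_comm 3 m])]

theorem UniqueDigit.eq_affine {b d m r : ℕ} {Y : Set ℕ} (hd : d < b) (h : r < m)
    (hu : UniqueDigit b d Y) (hq : digitQuotient b d Y = thueMorseAffine m r) :
    Y = thueMorseAffine (m * b) (r * b + d) := by
  have hb : 0 < b := by omega
  ext x
  have hx := Nat.div_add_mod' x b
  have hlt : r * b + d < m * b := mul_add_lt_mul h hd
  have h1 := mul_add_mem_thueMorseAffine_mul hb hlt (x / b) (x % b) (Nat.mod_lt _ hb)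
  rw [hx, Nat.mul_add_mod', Nat.mod_eq_of_lt hd, mul_comm r b, Nat.mul_add_div hb,
    Nat.div_eq_of_lt hd, add_zero, ← hq] at h1
  rw [mul_comm r b, h1]
  constructor
  · intro hxY
    have h2 : x % b = d := (hu (x % b) (Nat.mod_lt _ hb)).1 ⟨x / b, by rwa [hx]⟩
    refine ⟨h2, ?_⟩
    rw [digitQuotient, Set.mem_ofPred_eq, ← h2, hx]
    exact hxY
  · rintro ⟨h2, h3⟩
    rw [digitQuotient, Set.mem_ofPred_eq, ← h2, hx] at h3
    exact h3

theorem UniqueDigit.isAffine_iff {b d : ℕ} {Y : Set ℕ} (hb3 : b.Coprime 3) (hd : d < b)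
    (hu : UniqueDigit b d Y) : IsAffine Y ↔ IsAffine (digitQuotient b d Y) := by
  have hb : 0 < b := by omega
  constructor
  · rintro ⟨m, r, h, rfl⟩
    obtain ⟨k, rfl⟩ := hu.dvd hb hb3 h
    rw [mul_comm] at h hu ⊢
    have hdr : r % b = d := (hu (r % b) (Nat.mod_lt _ hb)).1
      (((uniqueDigit_affine hb h) _ (Nat.mod_lt _ hb)).2 rfl)
    refine ⟨k, r / b, Nat.div_lt_of_lt_mul (by rwa [mul_comm]), ?_⟩
    rw [← hdr, digitQuotient_affine hb h]
  · rintro ⟨m, r, h, hq⟩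
    exact ⟨m * b, r * b + d, mul_add_lt_mul h hd, hu.eq_affine hd h hq⟩

/-- Decides in `fnd` whether some reachable state leads to an accepting one by the digit `d`. -/
def testDigit : Cmd :=
  .assign .fnd (.lit 0) ;;
  .loop .q .N (.ite (.eq (.get .reach (.var .q)) (.lit 1))
    (.ite (.eq (.get .acc (.get .delta (.var .q * .var .base + .var .d))) (.lit 1))
      (.assign .fnd (.lit 1)) .skip) .skip)

/-- Computes the number `cnt` of the last digits of accepted words, and the largest one `sel`. -/
def findDigit : Cmd :=
  .assign .cnt (.lit 0) ;; .assign .sel (.lit 0) ;;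
  .loop .d .base (testDigit ;;
    .ite (.eq (.var .fnd) (.lit 1))
      (.assign .cnt (.var .cnt + .lit 1) ;; .assign .sel (.var .d)) .skip)

/-- Accepts those states that lead to an accepting one by the digit `sel`. -/
def shiftAccept : Cmd :=
  .loop .q .N (.put .new (.var .q) (.get .acc (.get .delta (.var .q * .var .base + .var .sel)))) ;;
  .loop .q .N (.put .acc (.var .q) (.get .new (.var .q)))

/-- Removes common last digits as often as possible. -/
def removeDigits : Cmd :=
  .loop .i .N (findDigit ;; .ite (.eq (.var .cnt) (.lit 1)) shiftAccept .skip)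

section
variable {p N W : ℕ} {β : Var → ℕ} {A : DFA (Fin (2 ^ p)) (Fin N)} {s : State}

/-- The digit `d` leads from a marked state to an accepting state. -/
def LiveDigit (A : DFA (Fin (2 ^ p)) (Fin N)) (s : State) (d : ℕ) : Prop :=
  ∃ (q : Fin N) (h : d < 2 ^ p), s.arr .reach q = 1 ∧ s.arr .acc (A.step q ⟨d, h⟩) = 1

theorem LiveDigit.congr {s' : State} (hr : s'.arr .reach = s.arr .reach)
    (ha : s'.arr .acc = s.arr .acc) (d : ℕ) : LiveDigit A s' d ↔ LiveDigit A s d := by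
  simp only [LiveDigit, hr, ha]

theorem spec_testDigit (hB : Bounds p N W β) (hL : Loaded A s) {d : ℕ} (hd : d < 2 ^ p)
    (hds : s.reg .d = d) :
    Spec W β testDigit s (fun s' => s'.reg .fnd = 1 ↔ LiveDigit A s d) := by
  have hW := hB.base_le
  have h2 := hB.two_le
  have hNb := hB.mul_le
  have h1 : 1 ≤ W := by omega
  simp only [testDigit, spec_seq, spec_assign, Expr.ok_lit]
  refine ⟨by omega, ?_⟩
  have hL0 : Loaded A (s.setReg .fnd (Expr.eval s (.lit 0))) := hL.frame rfl rfl rfl rfl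
  refine Spec.loop (fun k s' => s'.reg .fnd = 1 ↔ ∃ q : Fin N, (q : ℕ) < k ∧
    s.arr .reach q = 1 ∧ s.arr .acc (A.step q ⟨d, hd⟩) = 1) (by decide) ?_ ?_ ?_ ?_
  · simp [hL.card, hB.β_N]
  · simp
  · intro k s1 hk hf ha hq hI
    rw [hL0.card] at hk
    have hL1 := hL0.frame_loop _ _ hf ha
    have hd1 : s1.reg .d = d := (hf .d (by decide) (by decide)).trans hds
    have hr1 : s1.arr .reach = s.arr .reach := ha _ (by decide)
    have ha1 : s1.arr .acc = s.arr .acc := ha _ (by decide)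
    have hlt := mul_add_lt_mul hk hd
    have hdelta := hL1.delta ⟨k, hk⟩ ⟨d, hd⟩
    simp only at hdelta
    have hsucc : (∃ q : Fin N, (q : ℕ) < k + 1 ∧ s.arr .reach q = 1 ∧
        s.arr .acc (A.step q ⟨d, hd⟩) = 1) ↔ (∃ q : Fin N, (q : ℕ) < k ∧
        s.arr .reach q = 1 ∧ s.arr .acc (A.step q ⟨d, hd⟩) = 1) ∨
        (s.arr .reach k = 1 ∧ s.arr .acc (A.step ⟨k, hk⟩ ⟨d, hd⟩) = 1) := by
      constructor
      · rintro ⟨q, hq, h⟩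
        rcases Nat.lt_succ_iff_lt_or_eq.1 hq with hq | hq
        · exact .inl ⟨q, hq, h⟩
        · obtain rfl : q = ⟨k, hk⟩ := Fin.ext hq
          exact .inr h
      · rintro (⟨q, hq, h⟩ | h)
        · exact ⟨q, by omega, h⟩
        · exact ⟨⟨k, hk⟩, Nat.lt_succ_self k, h⟩
    simp only [spec_ite_eq, spec_assign, spec_skip, Expr.ok_get, Expr.ok_add, Expr.ok_mul,
      Expr.ok_var, Expr.ok_lit, Expr.eval_get, Expr.eval_add, Expr.eval_mul, Expr.eval_var,
      Expr.eval_lit, hq, hd1, hL1.base, hdelta, hr1, ha1, State.setReg_reg, hI, hsucc]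
    refine ⟨trivial, h1, fun h => ⟨⟨⟨trivial, trivial, by omega⟩, trivial, by omega⟩, h1, ?_, ?_⟩, ?_⟩
    · intro h'
      simp [h1, h, h']
    · intro h'
      simp [h', hI]
    · intro h
      simp [h, hI]
  · intro s1 hI
    rw [hI]
    constructor
    · rintro ⟨q, -, h⟩
      exact ⟨q, hd, h⟩
    · rintro ⟨q, _, h⟩
      exact ⟨q, by rw [hL0.card]; exact q.2, h⟩

open Classical in
theorem spec_findDigit (hB : Bounds p N W β) (hL : Loaded A s) :
    Spec W β findDigit s (fun s' =>
      (s'.reg .cnt = 1 → s'.reg .sel < 2 ^ p ∧ ∀ d < 2 ^ p, LiveDigit A s d ↔ d = s'.reg .sel) ∧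
      (s'.reg .cnt ≠ 1 → ∀ c < 2 ^ p, ¬ ∀ d < 2 ^ p, LiveDigit A s d ↔ d = c)) := by
  have hW := hB.base_le
  have h2 := hB.two_le
  have h1 : 1 ≤ W := by omega
  simp only [findDigit, spec_seq, spec_assign, Expr.ok_lit]
  refine ⟨by omega, by omega, ?_⟩
  set s0 := (s.setReg .cnt (Expr.eval s (.lit 0))).setReg .sel
    (Expr.eval (s.setReg .cnt (Expr.eval s (.lit 0))) (.lit 0)) with hs0
  have hL0 : Loaded A s0 := hL.frame rfl rfl rfl rfl
  -- `sel` is overwritten by each live digit; it matters only if `cnt = 1`, when it is the only one.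
  refine Spec.loop (fun k s' => s'.reg .cnt = ((Finset.range k).filter (LiveDigit A s)).card ∧
    (0 < s'.reg .cnt → s'.reg .sel < 2 ^ p ∧ LiveDigit A s (s'.reg .sel))) (by decide) ?_ ?_ ?_ ?_
  · simp [hL0.base, hB.β_base]
  · simp [hs0]
  · intro k s1 hk hf ha hd hI
    rw [hL0.base] at hk
    have hL1 := hL0.frame_loop _ _ hf ha
    rw [spec_seq]
    refine (spec_testDigit hB hL1 hk hd).mono ?_
    intro s2 hr ha2 hI2
    have hcnt : s2.reg .cnt = s1.reg .cnt := hr _ (by decide)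
    have hsel : s2.reg .sel = s1.reg .sel := hr _ (by decide)
    have hd2 : s2.reg .d = k := (hr _ (by decide)).trans hd
    have hs : LiveDigit A s1 k ↔ LiveDigit A s k :=
      LiveDigit.congr (ha _ (by decide)) (ha _ (by decide)) k
    rw [hs] at hI2
    have hle : s1.reg .cnt ≤ k := by
      rw [hI.1]
      exact (Finset.card_filter_le _ _).trans (by simp)
    simp only [spec_ite_eq, spec_seq, spec_assign, spec_skip, Expr.ok_add, Expr.ok_var, Expr.ok_lit,
      Expr.eval_add, Expr.eval_var, Expr.eval_lit, Finset.range_add_one, Finset.filter_insert]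
    refine ⟨trivial, h1, fun h => ⟨⟨trivial, h1, by omega⟩, trivial, ?_⟩, fun h => ?_⟩
    · rw [hI2] at h
      rw [if_pos h, Finset.card_insert_of_notMem (by simp)]
      simp [hcnt, hd2, hI.1, h, hk]
    · rw [hI2] at h
      rw [if_neg h]
      simpa [hcnt, hsel] using hI
  · intro s1 hI
    rw [hL0.base] at hI
    have hone : ∀ c < 2 ^ p, (∀ d < 2 ^ p, LiveDigit A s d ↔ d = c) → s1.reg .cnt = 1 := by
      intro c hc h
      rw [hI.1, Finset.card_eq_one]
      refine ⟨c, Finset.ext fun d => ?_⟩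
      rw [Finset.mem_filter, Finset.mem_range, Finset.mem_singleton]
      constructor
      · rintro ⟨hd, hl⟩
        exact (h d hd).1 hl
      · rintro rfl
        exact ⟨hc, (h d hc).2 rfl⟩
    refine ⟨fun h => ?_, fun h c hc hl => h (hone c hc hl)⟩
    obtain ⟨hsel, hlive⟩ := hI.2 (by omega)
    refine ⟨hsel, fun d hd => ⟨fun hl => ?_, fun he => he ▸ hlive⟩⟩
    have hc := hI.1.symm.trans h
    rw [Finset.card_eq_one] at hc
    obtain ⟨c, hc⟩ := hc
    have e1 : d ∈ ({c} : Finset ℕ) := hc ▸ Finset.mem_filter.2 ⟨Finset.mem_range.2 hd, hl⟩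
    have e2 : s1.reg .sel ∈ ({c} : Finset ℕ) :=
      hc ▸ Finset.mem_filter.2 ⟨Finset.mem_range.2 hsel, hlive⟩
    rw [Finset.mem_singleton] at e1 e2
    rw [e1, e2]

/-- The new marks go through the array `new`, since a successor may have a smaller number and its
old mark must not be overwritten before it is read. -/
theorem spec_shiftAccept (hB : Bounds p N W β) (hL : Loaded A s) {d : Fin (2 ^ p)}
    (hd : s.reg .sel = d) :
    Spec W β shiftAccept s (fun s' => ∀ q : Fin N, s'.arr .acc q = s.arr .acc (A.step q d)) := by
  have hNb := hB.mul_le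
  simp only [shiftAccept, spec_seq]
  refine Spec.loop (fun k s' => Loaded A s' ∧ ∀ q : Fin N, (q : ℕ) < k →
    s'.arr .new q = s.arr .acc (A.step q d)) (by decide) ?_ ?_ ?_ ?_
  · simp [hL.card, hB.β_N]
  · exact ⟨hL.frame rfl rfl rfl rfl, by simp⟩
  · intro k s1 hk hf ha hq hI
    rw [hL.card] at hk
    have hL1 := hI.1
    have hd1 : s1.reg .sel = d := (hf .sel (by decide) (by decide)).trans hd
    have ha1 : s1.arr .acc = s.arr .acc := ha _ (by decide)
    have hlt := mul_add_lt_mul hk d.2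
    have hdelta := hL1.delta ⟨k, hk⟩ d
    simp only at hdelta
    simp only [spec_put, Expr.ok_get, Expr.ok_add, Expr.ok_mul, Expr.ok_var, Expr.eval_get,
      Expr.eval_add, Expr.eval_mul, Expr.eval_var, hq, hd1, hL1.base, hdelta, ha1]
    refine ⟨trivial, ⟨⟨trivial, trivial, by omega⟩, trivial, by omega⟩,
      hL1.frame rfl rfl rfl (by simp), ?_⟩
    intro q hq
    rcases Nat.lt_succ_iff_lt_or_eq.1 hq with hq | hq
    · simp only [State.setReg_arr, State.setArr_arr, if_true, Function.update_of_ne hq.ne]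
      exact hI.2 q hq
    · obtain rfl : q = ⟨k, hk⟩ := Fin.ext hq
      simp
  · intro s1 hI
    rw [hL.card] at hI
    refine Spec.loop (fun k s' => ∀ q : Fin N, (q : ℕ) < k →
      s'.arr .acc q = s.arr .acc (A.step q d)) (by decide) ?_ ?_ ?_ ?_
    · simp [hI.1.card, hB.β_N]
    · simp
    · intro k s2 hk hf ha hq hI2
      rw [hI.1.card] at hk
      have ha1 : s2.arr .new = s1.arr .new := ha _ (by decide)
      simp only [spec_put, Expr.ok_get, Expr.ok_var, Expr.eval_get, Expr.eval_var, hq, ha1]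
      refine ⟨trivial, trivial, ?_⟩
      intro q hq
      rcases Nat.lt_succ_iff_lt_or_eq.1 hq with hq | hq
      · simp only [State.setReg_arr, State.setArr_arr, if_true, Function.update_of_ne hq.ne]
        exact hI2 q hq
      · obtain rfl : q = ⟨k, hk⟩ := Fin.ext hq
        simpa using hI.2 ⟨k, hk⟩ hk
    · intro s2 hI2 q
      exact hI2 q (by rw [hI.1.card]; exact q.2)

/-- The accepting states according to the array `acc`. -/
def accSet (N : ℕ) (s : State) : Set (Fin N) := {q | s.arr .acc q = 1}

/-- Only reachable states correspond to prefixes of numbers; this is why reachability is computed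
first. -/
theorem liveDigit_iff (hp : 1 ≤ p) (hreach : ∀ q : Fin N, s.arr .reach q = 1 ↔ ∃ w, A.eval w = q)
    {Y : Set ℕ} (hY : RecognizesWith A (accSet N s) Y) {d : ℕ} (hd : d < 2 ^ p) :
    LiveDigit A s d ↔ ∃ n, n * 2 ^ p + d ∈ Y := by
  have key := hY.step ⟨d, hd⟩
  constructor
  · rintro ⟨q, h, hq, ha⟩
    obtain ⟨w, rfl⟩ := (hreach q).1 hq
    exact ⟨wordVal w, (key w).1 ha⟩
  · rintro ⟨n, hn⟩
    obtain ⟨w, rfl⟩ := exists_word (Nat.one_lt_two_pow (by omega : p ≠ 0)) n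
    exact ⟨A.eval w, hd, (hreach _).2 ⟨w, rfl⟩, (key w).2 hn⟩

theorem spec_removeDigits (hB : Bounds p N W β) (hL : Loaded A s)
    (hreach : ∀ q : Fin N, s.arr .reach q = 1 ↔ ∃ w, A.eval w = q)
    (hacc : ∀ q : Fin N, s.arr .acc q ≤ 1) {Y : Set ℕ} (hY : RecognizesWith A (accSet N s) Y) :
    Spec W β removeDigits s (fun s' => (∀ q : Fin N, s'.arr .acc q ≤ 1) ∧
      ∃ Y', RecognizesWith A (accSet N s') Y' ∧ (IsAffine Y ↔ IsAffine Y') ∧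
        (IsAffine Y' → ∃ m r, r < m ∧ m ≤ 2 ^ p * N ∧ Y' = thueMorseAffine m r)) := by
  have hW := hB.base_le
  have h2 := hB.two_le
  have hb3 : (2 ^ p).Coprime 3 := Nat.Coprime.pow_left _ (by norm_num)
  have hb : 0 < 2 ^ p := by omega
  -- If `Y` is affine, then after `k` rounds either `2 ^ p` no longer divides the modulus, or every
  -- round has removed a digit and the original modulus was `m * 2 ^ (p * k)`.
  refine Spec.loop (fun k s' => Loaded A s' ∧ (∀ q : Fin N, s'.arr .acc q ≤ 1) ∧
      ∃ Y', RecognizesWith A (accSet N s') Y' ∧ (IsAffine Y ↔ IsAffine Y') ∧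
        (IsAffine Y → ∃ m r, r < m ∧ Y' = thueMorseAffine m r ∧
          (¬ 2 ^ p ∣ m ∨ ∃ r', r' < m * 2 ^ (p * k) ∧ Y = thueMorseAffine (m * 2 ^ (p * k)) r')))
      (by decide) ?_ ?_ ?_ ?_
  · simp [hL.card, hB.β_N]
  · refine ⟨hL.frame rfl rfl rfl rfl, hacc, Y, hY, Iff.rfl, ?_⟩
    rintro ⟨m, r, h, rfl⟩
    exact ⟨m, r, h, rfl, .inr ⟨r, by simpa using h, by simp⟩⟩
  · rintro k s1 hk hf ha - ⟨hL1, hacc1, Y1, hY1, hiff, hform⟩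
    have hr1 : s1.arr .reach = s.arr .reach := ha _ (by decide)
    rw [← hr1] at hreach
    rw [spec_seq]
    refine (spec_findDigit hB hL1).mono ?_
    rintro s2 hf2 ha2 ⟨hone, hnot⟩
    have hL2 : Loaded A s2 := hL1.frame_regs _ hf2 ha2
    have hacc2 : s2.arr .acc = s1.arr .acc := ha2 _ (by decide)
    simp only [spec_ite_eq, spec_skip, Expr.ok_var, Expr.ok_lit, Expr.eval_var, Expr.eval_lit]
    refine ⟨trivial, by omega, fun h => ?_, fun h => ?_⟩
    · obtain ⟨hsel, hlive⟩ := hone h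
      have hu : UniqueDigit (2 ^ p) (s2.reg .sel) Y1 := fun c hc => by
        rw [← liveDigit_iff hB.p_pos hreach hY1 hc]
        exact hlive c hc
      refine (spec_shiftAccept hB hL2 (d := ⟨_, hsel⟩) rfl).mono ?_
      intro s3 hf3 ha3 hacc3
      rw [hacc2] at hacc3
      refine ⟨(hL2.frame_regs _ hf3 ha3).frame rfl rfl rfl rfl, ?_,
        digitQuotient (2 ^ p) (s2.reg .sel) Y1, ?_, hiff.trans (hu.isAffine_iff hb3 hsel), ?_⟩
      · intro q
        rw [State.setReg_arr, hacc3]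
        exact hacc1 _
      · have : accSet N (s3.setReg .i (k + 1)) =
            {q | A.step q ⟨_, hsel⟩ ∈ accSet N s1} := by
          ext q
          simp [accSet, hacc3]
        rw [this]
        exact hY1.step ⟨_, hsel⟩
      · intro hYa
        obtain ⟨m, r, hr, rfl, hm⟩ := hform hYa
        have hdvd := hu.dvd hb hb3 hr
        obtain ⟨m', rfl⟩ := hdvd
        rcases hm with hm | ⟨r', hr', hYr'⟩
        -- A common last digit forces divisibility, so no digit is removed once the factors `2 ^ p`
        -- are exhausted.
        · exact absurd (dvd_mul_right _ _) hm
        rw [mul_comm (2 ^ p)] at hr hu ⊢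
        have hdr : r % 2 ^ p = s2.reg .sel := (hu _ (Nat.mod_lt _ hb)).1
          (((uniqueDigit_affine hb hr) _ (Nat.mod_lt _ hb)).2 rfl)
        have hpow : 2 ^ p * m' * 2 ^ (p * k) = m' * 2 ^ (p * (k + 1)) := by
          rw [Nat.mul_succ, pow_add]; ring
        refine ⟨m', r / 2 ^ p, Nat.div_lt_of_lt_mul (by rwa [mul_comm]), ?_, .inr ⟨r', ?_, ?_⟩⟩
        · rw [← hdr, digitQuotient_affine hb hr]
        · rwa [← hpow]
        · rwa [← hpow]
    · refine ⟨hL2.frame rfl rfl rfl rfl, ?_, Y1, ?_, hiff, ?_⟩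
      · intro q
        rw [State.setReg_arr, hacc2]
        exact hacc1 q
      · have : accSet N (s2.setReg .i (k + 1)) = accSet N s1 := by
          ext q
          simp [accSet, hacc2]
        rwa [this]
      · intro hYa
        obtain ⟨m, r, hr, rfl, -⟩ := hform hYa
        refine ⟨m, r, hr, rfl, .inl ?_⟩
        rintro ⟨m', rfl⟩
        rw [mul_comm (2 ^ p)] at hr hY1
        refine hnot h (r % 2 ^ p) (Nat.mod_lt _ hb) fun d hd => ?_
        rw [liveDigit_iff hB.p_pos hreach hY1 hd]
        exact uniqueDigit_affine hb hr d hd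
  · rintro s1 ⟨hL1, hacc1, Y1, hY1, hiff, hform⟩
    rw [hL.card] at hform
    refine ⟨hacc1, Y1, hY1, hiff, fun hYa => ?_⟩
    obtain ⟨m, r, hr, hY1m, hm⟩ := hform (hiff.2 hYa)
    refine ⟨m, r, hr, ?_, hY1m⟩
    -- If all `N` rounds had removed a digit, `2 ^ (p * N)` would divide the original modulus, which
    -- requires more than `N` states.
    have hnd : ¬ 2 ^ p ∣ m := by
      rcases hm with hm | ⟨r', hr', hYr'⟩
      · exact hm
      · rw [hYr'] at hY
        exact absurd (lt_card_of_two_pow_dvd hB.p_pos hr' hY (dvd_mul_left _ _)) (lt_irrefl N)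
    rw [hY1m] at hY1
    exact le_two_pow_mul_card hB.p_pos hr hY1 hnd

end

/-! ### Finding the candidates for `m` and `r` -/

/-- `1` and `2` are not in `T`. -/
theorem eq_of_mem_thueMorseAffine {m r n : ℕ} (hn : n ∈ thueMorseAffine m r)
    (hlt : n < r + 3 * m) : n = r := by
  obtain ⟨t, ht, rfl⟩ := hn
  rw [mem_thueMorseSet_iff] at ht
  have h3 : t < 3 := by
    by_contra h
    have : m * 3 ≤ m * t := Nat.mul_le_mul_left _ (by omega)
    simp only at hlt
    omega
  interval_cases t
  · simp
  · simp [tmBit] at ht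
  · simp [tmBit] at ht

/-- Computes the states reached by the expansions of the numbers below `lim` and derives `m` and `r`
from the first two of these numbers that are accepted. -/
def findCandidate : Cmd :=
  .put .state (.lit 0) (.var .start) ;;
  .assign .lim (.lit 4 * (.var .base * .var .N)) ;;
  .assign .cnt (.lit 0) ;; .assign .r (.lit 0) ;; .assign .m (.lit 0) ;;
  .loop .n .lim (
    .ite (.lt (.lit 0) (.var .n))
      (.put .state (.var .n) (.get .delta
        (.get .state (.var .n / .var .base) * .var .base + .var .n % .var .base))) .skip ;;
    .ite (.eq (.get .acc (.get .state (.var .n))) (.lit 1))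
      (.ite (.eq (.var .cnt) (.lit 0)) (.assign .r (.var .n) ;; .assign .cnt (.lit 1))
        (.ite (.eq (.var .cnt) (.lit 1))
          (.assign .m ((.var .n - .var .r) / .lit 3) ;; .assign .cnt (.lit 2)) .skip))
      .skip)

/-- The first two elements of `m T + r` below `k` are recorded. -/
def CandidateAt (Y : Set ℕ) (k : ℕ) (s : State) : Prop :=
  ∀ m r : ℕ, r < m → Y = thueMorseAffine m r → (k ≤ r → s.reg .cnt = 0) ∧
    (r < k → k ≤ r + 3 * m → s.reg .cnt = 1 ∧ s.reg .r = r) ∧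
    (r + 3 * m < k → s.reg .cnt = 2 ∧ s.reg .r = r ∧ s.reg .m = m)

section
variable {p N W : ℕ} {β : Var → ℕ} {A : DFA (Fin (2 ^ p)) (Fin N)} {s : State}

/-- The limit is large enough as `r + 3 * m < 4 * m`. The bound on the recorded modulus holds for
every `Y`, since the last phase must respect its time and word bounds even for a meaningless
candidate. -/
theorem spec_findCandidate (hB : Bounds p N W β) (hL : Loaded A s) {Y : Set ℕ}
    (hY : RecognizesWith A (accSet N s) Y) :
    Spec W β findCandidate s (fun s' => 3 * s'.reg .m ≤ 4 * (2 ^ p * N) ∧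
      ∀ m r, r < m → m ≤ 2 ^ p * N → Y = thueMorseAffine m r →
        s'.reg .r = r ∧ s'.reg .m = m) := by
  have hW := hB.base_le
  have h2 := hB.two_le
  have hb : 0 < 2 ^ p := by omega
  have hNb := hB.mul_le
  have hfour := hB.four_mul_le
  simp only [findCandidate, spec_seq, spec_assign, spec_put, Expr.ok_lit, Expr.ok_mul, Expr.ok_var,
    Expr.eval_lit, Expr.eval_mul, Expr.eval_var, State.setArr_reg, hL.base, hL.card,
    hL.start, State.setReg_reg]
  refine ⟨by omega, trivial, ⟨by omega, ⟨trivial, trivial, by omega⟩, hfour⟩,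
    by omega, by omega, by omega, ?_⟩
  set s0 := ((((s.setArr .state 0 A.start).setReg .lim (4 * (2 ^ p * N))).setReg .cnt 0).setReg
    .r 0).setReg .m 0 with hs0
  have hL0 : Loaded A s0 := hL.frame rfl rfl rfl (by simp [hs0])
  have hlim : s0.reg .lim = 4 * (2 ^ p * N) := by simp [hs0]
  -- Cell `0` is filled before the loop, by the state of the empty word; every `x > 0` extends the
  -- expansion of `x / 2 ^ p`.
  refine Spec.loop (fun k s' => (∀ x, x < k ∨ x = 0 →
      ∃ w, wordVal w = x ∧ s'.arr .state x = A.eval w) ∧ 3 * s'.reg .m ≤ 4 * (2 ^ p * N) ∧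
      CandidateAt Y k s') (by decide) ?_ ?_ ?_ ?_
  · simp [hlim, hB.β_lim]
  · refine ⟨?_, by simp [hs0], ?_⟩
    · rintro x (h | rfl)
      · omega
      · exact ⟨[], wordVal_nil, by simp [hs0]⟩
    · intro m r hr hYm
      simp [hs0]
  · rintro k s1 hk hf ha hn ⟨hst, hm, hc⟩
    rw [hlim] at hk
    have hL1 := hL0.frame_loop _ _ hf ha
    have hacc1 : s1.arr .acc = s.arr .acc := (ha _ (by decide)).trans (by simp [hs0])
    rw [spec_seq]
    have hfirst : Spec W β (.ite (.lt (.lit 0) (.var .n))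
      (.put .state (.var .n) (.get .delta
        (.get .state (.var .n / .var .base) * .var .base + .var .n % .var .base))) .skip) s1
        (fun s2 => ∀ x, x < k + 1 ∨ x = 0 →
          ∃ w, wordVal w = x ∧ s2.arr .state x = A.eval w) := by
      simp only [spec_ite_lt, spec_put, spec_skip, Expr.ok_lit, Expr.ok_get, Expr.ok_add,
        Expr.ok_mul, Expr.ok_div, Expr.ok_mod, Expr.ok_var, Expr.eval_lit, Expr.eval_get,
        Expr.eval_add, Expr.eval_mul, Expr.eval_div, Expr.eval_mod, Expr.eval_var, hn, hL1.base]
      refine ⟨by omega, trivial, fun hpos => ?_, fun hzero => ?_⟩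
      · have hdiv : k / 2 ^ p < k := Nat.div_lt_self hpos (by omega)
        have hmod : k % 2 ^ p < 2 ^ p := Nat.mod_lt _ hb
        obtain ⟨w, hw, hwq⟩ := hst (k / 2 ^ p) (.inl hdiv)
        have hlt := mul_add_lt_mul (A.eval w).2 hmod
        have hdelta := hL1.delta (A.eval w) ⟨k % 2 ^ p, hmod⟩
        simp only at hdelta
        rw [hwq, hdelta]
        refine ⟨trivial, ⟨⟨⟨trivial, trivial⟩, trivial, by omega⟩, ⟨trivial, trivial⟩, by omega⟩, ?_⟩
        intro x hx
        by_cases hxk : x = k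
        · subst hxk
          refine ⟨w ++ [⟨x % 2 ^ p, hmod⟩], ?_, ?_⟩
          · rw [wordVal_append_singleton, hw]
            exact Nat.div_add_mod' _ _
          · simp
        · simp only [State.setArr_arr, if_true, Function.update_of_ne hxk]
          exact hst x (by omega)
      · intro x hx
        exact hst x (by omega)
    refine hfirst.mono ?_
    intro s2 hf2 ha2 hst2
    have hacc2 : s2.arr .acc = s.arr .acc := (ha2 _ (by decide)).trans hacc1
    have hn2 : s2.reg .n = k := (hf2 _ (by decide)).trans hn
    have hcnt2 : s2.reg .cnt = s1.reg .cnt := hf2 _ (by decide)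
    have hr2 : s2.reg .r = s1.reg .r := hf2 _ (by decide)
    have hm2 : s2.reg .m = s1.reg .m := hf2 _ (by decide)
    obtain ⟨w, hw, hwq⟩ := hst2 k (.inl (Nat.lt_succ_self k))
    have hmem : s.arr .acc (A.eval w) = 1 ↔ k ∈ Y := by
      rw [← hw]
      exact hY w
    simp only [spec_ite_eq, spec_seq, spec_assign, spec_skip, Expr.ok_lit, Expr.ok_get, Expr.ok_sub,
      Expr.ok_div, Expr.ok_var, Expr.eval_lit, Expr.eval_get, Expr.eval_sub, Expr.eval_div,
      Expr.eval_var, hn2, hcnt2, hr2, hacc2, hwq, hmem, State.setReg_arr]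
    have hh : ∀ m r, r < m → Y = thueMorseAffine m r →
        (k ∈ Y → k = r ∨ r + 3 * m ≤ k) ∧ r ∈ Y ∧ r + 3 * m ∈ Y := by
      rintro m r hr rfl
      refine ⟨fun hk => ?_, ?_, ?_⟩
      · by_contra! h
        exact h.1 (eq_of_mem_thueMorseAffine hk (by omega))
      · simpa using (mul_add_mem_thueMorseAffine_iff hr 0).2 tmBit_zero
      · have := (mul_add_mem_thueMorseAffine_iff hr 3).2 tmBit_three
        rwa [add_comm, mul_comm 3 m]
    refine ⟨trivial, by omega, fun hin => ⟨trivial, by omega, fun h0 => ⟨trivial, by omega, hst2, ?_,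
      ?_⟩, fun h0 => ⟨trivial, by omega, fun h1 => ⟨⟨⟨trivial, trivial⟩, by omega⟩, by omega, hst2, ?_,
      ?_⟩, fun h1 => ⟨hst2, ?_, ?_⟩⟩⟩, fun hin => ⟨hst2, ?_, ?_⟩⟩
    · simpa [hm2] using hm
    · intro m r hr hYm
      obtain ⟨e1, e2, e3⟩ := hc m r hr hYm
      obtain ⟨e4, -, -⟩ := hh m r hr hYm
      have e5 := e4 hin
      simp [hn2]
      omega
    · simp [hn2, hr2]
      omega
    · intro m r hr hYm
      obtain ⟨e1, e2, e3⟩ := hc m r hr hYm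
      obtain ⟨e4, -, -⟩ := hh m r hr hYm
      have e5 := e4 hin
      simp [hn2, hr2]
      omega
    · simpa [hm2] using hm
    · intro m r hr hYm
      obtain ⟨e1, e2, e3⟩ := hc m r hr hYm
      obtain ⟨e4, -, -⟩ := hh m r hr hYm
      have e5 := e4 hin
      simp [hn2, hr2, hcnt2, hm2]
      omega
    · simpa [hm2] using hm
    · intro m r hr hYm
      obtain ⟨e1, e2, e3⟩ := hc m r hr hYm
      obtain ⟨-, e4, e5⟩ := hh m r hr hYm
      have e6 : k ≠ r := fun h => hin (h ▸ e4)
      have e7 : k ≠ r + 3 * m := fun h => hin (h ▸ e5)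
      simp [hn2, hr2, hcnt2, hm2]
      omega
  · rintro s1 ⟨-, hm, hc⟩
    rw [hlim] at hc
    refine ⟨hm, fun m r hr hle hYm => ?_⟩
    exact ((hc m r hr hYm).2.2 (by omega)).2

end

/-! ### Comparison with `m T + r` -/

/-- Tabulates `tmBit` on the digits. -/
def computeBits : Cmd :=
  .loop .d .base
    (.put .bits (.var .d) ((.get .bits (.var .d / .lit 2) + .var .d) % .lit 2))

/-- Enters the successor of the current vertex by the digit `d` into the queue. -/
def pushSuccessor : Cmd :=
  .assign .x (.var .j * .var .base + .var .d) ;;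
  .assign .w (.lit 2 * (.get .delta (.var .q * .var .base + .var .d) * .var .m + .var .x % .var .m) +
    (.var .e + .get .bits (.var .x / .var .m)) % .lit 2) ;;
  .ite (.eq (.get .visited (.var .w)) (.lit 0))
    (.put .visited (.var .w) (.lit 1) ;; .put .queue (.var .tail) (.var .w) ;;
      .assign .tail (.var .tail + .lit 1)) .skip

/-- Decodes the vertex at position `h` of the queue and tests whether it is accepted correctly. -/
def testVertex : Cmd :=
  .assign .v (.get .queue (.var .h)) ;;
  .assign .e (.var .v % .lit 2) ;;
  .assign .j (.var .v / .lit 2 % .var .m) ;;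
  .assign .q (.var .v / .lit 2 / .var .m) ;;
  .assign .t (.lit 0) ;;
  .ite (.eq (.var .j) (.var .r)) (.assign .t (.lit 1 - .var .e)) .skip ;;
  .ite (.eq (.get .acc (.var .q)) (.var .t)) .skip (.assign .ok (.lit 0))

def processVertex : Cmd := testVertex ;; .loop .d .base pushSuccessor

/-- Decides in `ok` whether the automaton accepts `m T + r`. -/
def checkCandidate : Cmd :=
  .assign .ok (.lit 0) ;;
  .ite (.lt (.var .r) (.var .m))
    (.assign .ok (.lit 1) ;;
      .assign .size (.lit 2 * (.var .m * .var .N)) ;;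
      .assign .w (.lit 2 * (.var .start * .var .m)) ;;
      .put .queue (.lit 0) (.var .w) ;;
      .put .visited (.var .w) (.lit 1) ;;
      .assign .tail (.lit 1) ;;
      .loop .h .size (.ite (.lt (.var .h) (.var .tail)) processVertex .skip)) .skip

section
variable {p N W : ℕ} {β : Var → ℕ} {A : DFA (Fin (2 ^ p)) (Fin N)} {s : State}

theorem spec_computeBits (hB : Bounds p N W β) (hb : s.reg .base = 2 ^ p)
    (h0 : ∀ j, s.arr .bits j = 0) :
    Spec W β computeBits s (fun s' => ∀ x < 2 ^ p, s'.arr .bits x = tmBit x) := by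
  have hW := hB.base_le
  have h2 := hB.two_le
  -- The entry at `0` is correct from the start because the array is initially zero; the recursion
  -- reads it for the digits `0` and `1`.
  refine Spec.loop (fun k s' => ∀ x, x < k ∨ x = 0 → s'.arr .bits x = tmBit x) (by decide)
    ?_ ?_ ?_ ?_
  · simp [hb, hB.β_base]
  · rintro x (h | rfl)
    · omega
    · simp [h0, tmBit_zero]
  · intro k s1 hk hf ha hd hI
    rw [hb] at hk
    have hhalf := hI (k / 2) (by omega)
    have hlt := tmBit_lt_two (k / 2)
    simp only [spec_put, Expr.ok_mod, Expr.ok_add, Expr.ok_get, Expr.ok_div, Expr.ok_var,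
      Expr.ok_lit, Expr.eval_mod, Expr.eval_add, Expr.eval_get, Expr.eval_div, Expr.eval_var,
      Expr.eval_lit, hd, hhalf]
    refine ⟨trivial, ⟨⟨⟨trivial, by omega⟩, trivial, by omega⟩, by omega⟩, ?_⟩
    intro x hx
    by_cases hxk : x = k
    · subst hxk
      simpa using (tmBit_eq_half x).symm
    · simp only [State.setReg_arr, State.setArr_arr, if_true, Function.update_of_ne hxk]
      exact hI x (by omega)
  · intro s1 hI x hx
    exact hI x (.inl (by rwa [hb]))

/-! ### The product graph and its exploration -/

/-- The code of the pair of states that `A` and the automaton of `m T + r` reach by reading `w`. -/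
def vertex (A : DFA (Fin (2 ^ p)) (Fin N)) (m : ℕ) (w : List (Fin (2 ^ p))) : ℕ :=
  2 * (A.eval w * m + wordVal w % m) + tmBit (wordVal w / m)

theorem vertex_lt {m : ℕ} (hm : 0 < m) (w : List (Fin (2 ^ p))) :
    vertex A m w < 2 * (m * N) := by
  have h1 := tmBit_lt_two (wordVal w / m)
  have h2 := mul_add_lt_mul (A.eval w).2 (Nat.mod_lt (wordVal w) hm)
  rw [mul_comm m N]
  unfold vertex
  omega

theorem vertex_mod_two (m : ℕ) (w : List (Fin (2 ^ p))) :
    vertex A m w % 2 = tmBit (wordVal w / m) := by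
  rw [vertex, Nat.mul_add_mod, Nat.mod_eq_of_lt (tmBit_lt_two _)]

theorem vertex_div_two (m : ℕ) (w : List (Fin (2 ^ p))) :
    vertex A m w / 2 = A.eval w * m + wordVal w % m := by
  rw [vertex, Nat.mul_add_div (by norm_num), Nat.div_eq_of_lt (tmBit_lt_two _), add_zero]

theorem vertex_div_two_mod (m : ℕ) (w : List (Fin (2 ^ p))) :
    vertex A m w / 2 % m = wordVal w % m := by
  rw [vertex_div_two, Nat.mul_add_mod', Nat.mod_mod]

theorem vertex_div_two_div {m : ℕ} (hm : 0 < m) (w : List (Fin (2 ^ p))) :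
    vertex A m w / 2 / m = A.eval w := by
  rw [vertex_div_two, mul_comm, Nat.mul_add_div hm, Nat.div_eq_of_lt (Nat.mod_lt _ hm), add_zero]

theorem vertex_inj {m : ℕ} (hm : 0 < m) {w w' : List (Fin (2 ^ p))}
    (h : vertex A m w = vertex A m w') : A.eval w = A.eval w' ∧ wordVal w % m = wordVal w' % m ∧
      tmBit (wordVal w / m) = tmBit (wordVal w' / m) :=
  ⟨Fin.ext (by rw [← vertex_div_two_div hm, ← vertex_div_two_div hm, h]),
    by rw [← vertex_div_two_mod (A := A), ← vertex_div_two_mod (A := A), h],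
    by rw [← vertex_mod_two (A := A), ← vertex_mod_two (A := A), h]⟩

/-- The successor depends on the vertex only. With `j` the residue of the value of `w`, the new
quotient by `m` is the old one followed by the base-`2 ^ p` digit `(j * 2 ^ p + d) / m`, so the
parities add. -/
theorem vertex_append_singleton {m : ℕ} (hm : 0 < m) (w : List (Fin (2 ^ p))) (d : Fin (2 ^ p)) :
    vertex A m (w ++ [d]) = 2 * (A.step (A.eval w) d * m + (wordVal w % m * 2 ^ p + d) % m) +
      (tmBit (wordVal w / m) + tmBit ((wordVal w % m * 2 ^ p + d) / m)) % 2 := by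
  have h : wordVal w * 2 ^ p + d = m * (wordVal w / m * 2 ^ p) + (wordVal w % m * 2 ^ p + d) := by
    conv_lhs => rw [← Nat.div_add_mod (wordVal w) m]
    ring
  have hlt : (wordVal w % m * 2 ^ p + d) / m < 2 ^ p :=
    Nat.div_lt_of_lt_mul (mul_add_lt_mul (Nat.mod_lt _ hm) d.2)
  rw [vertex, wordVal_append_singleton, DFA.eval_append_singleton, h, Nat.mul_add_mod,
    Nat.mul_add_div hm, tmBit_mul_two_pow_add _ _ _ hlt]

/-- The queue contains pairwise different vertices, among them all that are marked as visited. -/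
structure QueueOk (A : DFA (Fin (2 ^ p)) (Fin N)) (m : ℕ) (s : State) : Prop where
  vertex (i : ℕ) (h : i < s.reg .tail) : ∃ w, s.arr .queue i = vertex A m w
  mem (v : ℕ) (h : s.arr .visited v ≠ 0) : ∃ i < s.reg .tail, s.arr .queue i = v
  visited (i : ℕ) (h : i < s.reg .tail) : s.arr .visited (s.arr .queue i) ≠ 0
  inj (i j : ℕ) (hi : i < s.reg .tail) (hj : j < s.reg .tail)
    (h : s.arr .queue i = s.arr .queue j) : i = j

theorem QueueOk.congr {m : ℕ} (h : QueueOk A m s) {s' : State} (ht : s'.reg .tail = s.reg .tail)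
    (hq : s'.arr .queue = s.arr .queue) (hv : s'.arr .visited = s.arr .visited) :
    QueueOk A m s' :=
  ⟨by rw [ht, hq]; exact h.1, by rw [ht, hq, hv]; exact h.2, by rw [ht, hq, hv]; exact h.3,
    by rw [ht, hq]; exact h.4⟩

/-- The queue has no repetitions and its entries are codes below `2 * (m * N)`. -/
theorem QueueOk.tail_le {m : ℕ} (hm : 0 < m) (h : QueueOk A m s) :
    s.reg .tail ≤ 2 * (m * N) := by
  have h1 : ((Finset.range (s.reg .tail)).image (s.arr .queue)).card = s.reg .tail := by
    rw [Finset.card_image_of_injOn, Finset.card_range]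
    intro i hi j hj hij
    exact h.inj i j (by simpa using hi) (by simpa using hj) hij
  rw [← h1]
  refine (Finset.card_le_card (t := Finset.range (2 * (m * N))) ?_).trans (by simp)
  intro v hv
  obtain ⟨i, hi, rfl⟩ := Finset.mem_image.1 hv
  obtain ⟨w, hw⟩ := h.vertex i (by simpa using hi)
  rw [hw, Finset.mem_range]
  exact vertex_lt hm w

/-- Entries have been added to the queue and to the visited vertices, and none removed. -/
structure QueueLe (s s' : State) : Prop where
  tail : s.reg .tail ≤ s'.reg .tail
  queue (i : ℕ) (h : i < s.reg .tail) : s'.arr .queue i = s.arr .queue i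
  visited (v : ℕ) (h : s.arr .visited v ≠ 0) : s'.arr .visited v ≠ 0

theorem QueueLe.of_eq {s' : State} (ht : s'.reg .tail = s.reg .tail)
    (hq : s'.arr .queue = s.arr .queue) (hv : s'.arr .visited = s.arr .visited) : QueueLe s s' :=
  ⟨ht.ge, fun _ _ => by rw [hq], fun _ h => by rwa [hv]⟩

theorem QueueLe.trans {s' s'' : State} (h : QueueLe s s') (h' : QueueLe s' s'') : QueueLe s s'' :=
  ⟨h.1.trans h'.1, fun i hi => (h'.2 i (hi.trans_le h.1)).trans (h.2 i hi),
    fun v hv => h'.3 v (h.3 v hv)⟩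

theorem QueueOk.push {m : ℕ} (h : QueueOk A m s) {w : List (Fin (2 ^ p))}
    (hv : s.arr .visited (_root_.vertex A m w) = 0) {s' : State}
    (ht : s'.reg .tail = s.reg .tail + 1)
    (hq : s'.arr .queue = Function.update (s.arr .queue) (s.reg .tail) (_root_.vertex A m w))
    (hv' : s'.arr .visited = Function.update (s.arr .visited) (_root_.vertex A m w) 1) :
    QueueOk A m s' ∧ QueueLe s s' ∧ s'.arr .visited (_root_.vertex A m w) ≠ 0 := by
  have hold : ∀ i < s.reg .tail, s'.arr .queue i = s.arr .queue i := fun i hi => by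
    rw [hq, Function.update_of_ne hi.ne]
  have hnew : s'.arr .queue (s.reg .tail) = _root_.vertex A m w := by rw [hq, Function.update_self]
  have hne : ∀ i < s.reg .tail, s'.arr .queue i ≠ _root_.vertex A m w := fun i hi he =>
    h.visited i hi (by rw [← hold i hi, he, hv])
  have hvis : ∀ v, s.arr .visited v ≠ 0 → s'.arr .visited v ≠ 0 := fun v hvv => by
    rw [hv', Function.update_apply]
    split_ifs
    exacts [one_ne_zero, hvv]
  have hself : s'.arr .visited (_root_.vertex A m w) ≠ 0 := by simp [hv']
  refine ⟨⟨fun i hi => ?_, fun v hvv => ?_, fun i hi => ?_, fun i j hi hj hij => ?_⟩,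
    ⟨by omega, hold, hvis⟩, hself⟩
  · rw [ht, Nat.lt_succ_iff_lt_or_eq] at hi
    rcases hi with hi | rfl
    · rw [hold i hi]
      exact h.vertex i hi
    · exact ⟨w, hnew⟩
  · by_cases hvw : v = _root_.vertex A m w
    · exact ⟨s.reg .tail, by omega, hvw ▸ hnew⟩
    · rw [hv', Function.update_of_ne hvw] at hvv
      obtain ⟨i, hi, he⟩ := h.mem v hvv
      exact ⟨i, by omega, by rw [hold i hi, he]⟩
  · rw [ht, Nat.lt_succ_iff_lt_or_eq] at hi
    rcases hi with hi | rfl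
    · rw [hold i hi]
      exact hvis _ (h.visited i hi)
    · rwa [hnew]
  · rw [ht, Nat.lt_succ_iff_lt_or_eq] at hi hj
    rcases hi with hi | rfl <;> rcases hj with hj | rfl
    · rw [hold i hi, hold j hj] at hij
      exact h.inj i j hi hj hij
    · exact absurd (hij.trans hnew) (hne i hi)
    · exact absurd (hij.symm.trans hnew) (hne j hj)
    · rfl

/-- The bounds needed for the modulus `m`. -/
structure ModulusOk (p N W m : ℕ) : Prop where
  pos : 0 < m
  mul_base : m * 2 ^ p ≤ W
  mul_card : 2 * (m * N) + 1 ≤ W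

theorem spec_pushSuccessor (hB : Bounds p N W β) (hL : Loaded A s) {m : ℕ} (hm : ModulusOk p N W m)
    (hms : s.reg .m = m) (hbits : ∀ x < 2 ^ p, s.arr .bits x = tmBit x) (hQ : QueueOk A m s)
    {w : List (Fin (2 ^ p))} (hq : s.reg .q = A.eval w) (hj : s.reg .j = wordVal w % m)
    (he : s.reg .e = tmBit (wordVal w / m)) {d : Fin (2 ^ p)} (hd : s.reg .d = d) :
    Spec W β pushSuccessor s (fun s' => QueueOk A m s' ∧ QueueLe s s' ∧
      s'.arr .visited (vertex A m (w ++ [d])) ≠ 0) := by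
  have hW := hB.base_le
  have h2 := hB.two_le
  have hNb := hB.mul_le
  have hmb := hm.mul_base
  have hmN := hm.mul_card
  have hx := mul_add_lt_mul (Nat.mod_lt (wordVal w) hm.pos) d.2
  have hqd := mul_add_lt_mul (A.eval w).2 d.2
  have hlt : (wordVal w % m * 2 ^ p + d) / m < 2 ^ p := Nat.div_lt_of_lt_mul hx
  have hdelta := hL.delta (A.eval w) d
  have ht1 := tmBit_lt_two (wordVal w / m)
  have ht2 := tmBit_lt_two ((wordVal w % m * 2 ^ p + d) / m)
  have hv := vertex_append_singleton (A := A) hm.pos w d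
  have hvlt := vertex_lt (A := A) hm.pos (w ++ [d])
  have htail := hQ.tail_le hm.pos
  simp only [pushSuccessor, spec_seq, spec_assign, spec_put, spec_ite_eq, spec_skip, Expr.ok_lit,
    Expr.ok_var, Expr.ok_add, Expr.ok_mul, Expr.ok_get, Expr.ok_mod, Expr.ok_div, Expr.eval_lit,
    Expr.eval_var, Expr.eval_add, Expr.eval_mul, Expr.eval_get, Expr.eval_mod, Expr.eval_div,
    State.setReg_reg, State.setReg_arr, State.setArr_reg, hj, hL.base, hd, hq, hdelta, hms, he,
    reduceCtorEq, if_true, if_false, hbits _ hlt, ← hv, true_and, and_true]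
  refine ⟨by omega, ⟨⟨by omega, by omega, by omega⟩, by omega, by omega⟩, by omega,
    fun hvis => ⟨by omega, by omega, ?_⟩, fun hvis => ⟨hQ.congr rfl rfl rfl, .of_eq rfl rfl rfl, hvis⟩⟩
  exact hQ.push hvis (by simp) (by simp) (by simp)

theorem spec_testVertex (hB : Bounds p N W β) {m r : ℕ} (hm : ModulusOk p N W m)
    (hr : r < m) (hms : s.reg .m = m) (hrs : s.reg .r = r) (hacc : ∀ q : Fin N, s.arr .acc q ≤ 1)
    {w : List (Fin (2 ^ p))} (hv : s.arr .queue (s.reg .h) = vertex A m w) :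
    Spec W β testVertex s (fun s' => s'.reg .q = A.eval w ∧ s'.reg .j = wordVal w % m ∧
      s'.reg .e = tmBit (wordVal w / m) ∧ (s'.reg .ok = 1 ↔ s.reg .ok = 1 ∧
        (A.eval w ∈ accSet N s ↔ wordVal w ∈ thueMorseAffine m r))) := by
  have hW := hB.base_le
  have h2 := hB.two_le
  have h3 := hacc (A.eval w)
  have h4 := tmBit_lt_two (wordVal w / m)
  have hmem := mem_thueMorseAffine_iff hr (wordVal w)
  simp only [testVertex, spec_seq, spec_assign, spec_put, spec_ite_eq, spec_skip, Expr.ok_lit,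
    Expr.ok_var, Expr.ok_sub, Expr.ok_get, Expr.ok_mod, Expr.ok_div, Expr.eval_lit,
    Expr.eval_var, Expr.eval_sub, Expr.eval_get, Expr.eval_mod, Expr.eval_div,
    State.setReg_reg, State.setReg_arr, State.setArr_reg, hv, vertex_mod_two, vertex_div_two_mod,
    vertex_div_two_div hm.pos, hms, hrs, reduceCtorEq, if_true, if_false, true_and, and_true,
    accSet, Set.mem_ofPred_eq, hmem]
  refine ⟨by omega, by omega, by omega, by omega, fun h => ⟨by omega, fun h' => ?_,
    fun h' => ⟨by omega, ?_⟩⟩, fun h => ⟨fun h' => ?_, fun h' => ⟨by omega, ?_⟩⟩⟩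
  all_goals
    rcases (by omega : tmBit (wordVal w / m) = 0 ∨ tmBit (wordVal w / m) = 1) with h5 | h5 <;>
      rcases (by omega : s.arr .acc (A.eval w) = 0 ∨ s.arr .acc (A.eval w) = 1) with h6 | h6 <;>
        simp [h, h5, h6] at h' ⊢

theorem spec_processVertex (hB : Bounds p N W β) (hL : Loaded A s) {m r : ℕ}
    (hm : ModulusOk p N W m) (hr : r < m) (hms : s.reg .m = m) (hrs : s.reg .r = r)
    (hacc : ∀ q : Fin N, s.arr .acc q ≤ 1) (hbits : ∀ x < 2 ^ p, s.arr .bits x = tmBit x)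
    (hQ : QueueOk A m s) {w : List (Fin (2 ^ p))}
    (hv : s.arr .queue (s.reg .h) = vertex A m w) :
    Spec W β processVertex s (fun s' => QueueOk A m s' ∧ QueueLe s s' ∧
      (∀ d, s'.arr .visited (vertex A m (w ++ [d])) ≠ 0) ∧
      (s'.reg .ok = 1 ↔ s.reg .ok = 1 ∧
        (A.eval w ∈ accSet N s ↔ wordVal w ∈ thueMorseAffine m r))) := by
  rw [processVertex, spec_seq]
  refine (spec_testVertex hB hm hr hms hrs hacc hv).mono ?_
  rintro s1 hf1 ha1 ⟨hq, hj, he, hok⟩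
  have hL1 : Loaded A s1 := hL.frame_regs _ hf1 ha1
  refine Spec.loop (fun k s' => QueueOk A m s' ∧ QueueLe s s' ∧ s'.reg .ok = s1.reg .ok ∧
    ∀ d : Fin (2 ^ p), (d : ℕ) < k → s'.arr .visited (vertex A m (w ++ [d])) ≠ 0) (by decide)
    ?_ ?_ ?_ ?_
  · simp [hL1.base, hB.β_base]
  · exact ⟨hQ.congr (hf1 _ (by decide)) (ha1 _ (by decide)) (ha1 _ (by decide)),
      .of_eq (hf1 _ (by decide)) (ha1 _ (by decide)) (ha1 _ (by decide)), rfl, by simp⟩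
  · rintro k s2 hk hf2 ha2 hd ⟨hQ2, hle2, hok2, hvis2⟩
    rw [hL1.base] at hk
    have hbits2 : s2.arr .bits = s.arr .bits := (ha2 _ (by decide)).trans (ha1 _ (by decide))
    refine (spec_pushSuccessor (w := w) hB (hL1.frame_loop _ _ hf2 ha2) hm
      (((hf2 _ (by decide) (by decide)).trans (hf1 _ (by decide))).trans hms)
      (by rwa [hbits2]) hQ2 ((hf2 _ (by decide) (by decide)).trans hq)
      ((hf2 _ (by decide) (by decide)).trans hj) ((hf2 _ (by decide) (by decide)).trans he)
      (d := ⟨k, hk⟩) hd).mono ?_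
    rintro s3 hf3 - ⟨hQ3, hle3, hvis3⟩
    refine ⟨hQ3.congr rfl rfl rfl, (hle2.trans hle3).trans (.of_eq rfl rfl rfl),
      (hf3 .ok (by decide)).trans hok2, fun d hd => ?_⟩
    rcases Nat.lt_succ_iff_lt_or_eq.1 hd with hd | hd
    · exact hle3.visited _ (hvis2 d hd)
    · obtain rfl : d = ⟨k, hk⟩ := Fin.ext hd
      exact hvis3
  · rintro s2 ⟨hQ2, hle2, hok2, hvis2⟩
    refine ⟨hQ2, hle2, fun d => hvis2 d ?_, by rw [hok2, hok]⟩
    rw [hL1.base]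
    exact d.2

theorem eq_affine_iff_forall (hp : 1 ≤ p) {F : Set (Fin N)} {Y : Set ℕ}
    (hY : RecognizesWith A F Y) (m r : ℕ) :
    Y = thueMorseAffine m r ↔ ∀ w, A.eval w ∈ F ↔ wordVal w ∈ thueMorseAffine m r := by
  constructor
  · rintro rfl
    exact hY
  · intro h
    ext n
    obtain ⟨w, rfl⟩ := exists_word (Nat.one_lt_two_pow (by omega : p ≠ 0)) n
    rw [← hY w, h w]

/-- All vertices reached by words enter the queue, and each is tested once. Words with the same
vertex agree on membership in both sets, so the tests decide equality. The loop over `h` has a fixed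
number of rounds, at least the final length of the queue; surplus rounds do nothing. -/
theorem spec_checkCandidate (hB : Bounds p N W β) (hL : Loaded A s)
    (hms : 3 * s.reg .m ≤ 4 * (2 ^ p * N)) (hacc : ∀ q : Fin N, s.arr .acc q ≤ 1)
    (hbits : ∀ x < 2 ^ p, s.arr .bits x = tmBit x) (hvis : ∀ j, s.arr .visited j = 0)
    {Y : Set ℕ} (hY : RecognizesWith A (accSet N s) Y) :
    Spec W β checkCandidate s (fun s' => s'.reg .ok = 1 ↔
      s.reg .r < s.reg .m ∧ Y = thueMorseAffine (s.reg .m) (s.reg .r)) := by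
  have hW := hB.base_le
  have h2 := hB.two_le
  have hN := hB.card_pos
  simp only [checkCandidate, spec_seq, spec_assign, spec_put, spec_ite_lt, spec_skip, Expr.ok_lit,
    Expr.ok_var, Expr.ok_mul, Expr.eval_lit, Expr.eval_var, Expr.eval_mul,
    State.setReg_reg, State.setReg_arr, State.setArr_reg, reduceCtorEq, if_true, if_false, true_and,
    and_true, hL.card, hL.start]
  -- If `r < m` fails, `ok` stays `0`; this includes `m = 0`, the value left when no second element
  -- was found.
  refine ⟨by omega, fun hrm => ?_, fun hrm => ⟨fun h => absurd h (by norm_num), fun h => absurd h.1 hrm⟩⟩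
  obtain ⟨m, hm0⟩ : ∃ m, m = s.reg .m := ⟨_, rfl⟩
  obtain ⟨r, hr0⟩ : ∃ r, r = s.reg .r := ⟨_, rfl⟩
  rw [← hm0, ← hr0] at hrm ⊢
  rw [← hm0] at hms
  have hbN : 2 ^ p * N ≤ (2 ^ p) ^ 2 * N ^ 2 := by
    rw [← mul_pow]
    exact Nat.le_self_pow (by norm_num) _
  -- From `3 * m ≤ 4 * 2 ^ p * N` the number of vertices is at most `8 / 3` times `2 ^ p * N ^ 2`;
  -- this is the origin of the factor `3` in the loop bound for `size`.
  have hmN : 3 * (2 * (m * N)) ≤ 3 * (3 * (2 ^ p * N ^ 2)) := by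
    have := Nat.mul_le_mul_right N hms
    nlinarith
  have hmb : 3 * (m * 2 ^ p) ≤ 4 * ((2 ^ p) ^ 2 * N ^ 2) := by
    have := Nat.mul_le_mul_right (2 ^ p) hms
    have hNN : N ≤ N ^ 2 := Nat.le_self_pow (by norm_num) _
    have := Nat.mul_le_mul_left ((2 ^ p) ^ 2) hNN
    nlinarith
  have hbb : 2 * (2 ^ p * N ^ 2) ≤ (2 ^ p) ^ 2 * N ^ 2 := by
    have := Nat.mul_le_mul_right (2 ^ p * N ^ 2) h2
    nlinarith
  have hle := hB.le
  have hpos : 0 < 2 ^ p * N := by positivity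
  have hm : ModulusOk p N W m := ⟨by omega, by omega, by omega⟩
  have hv0 := vertex_lt (A := A) hm.pos []
  have hv0' : 2 * (A.start * m) = vertex A m [] := by
    simp [vertex, wordVal_nil, tmBit_zero]
  have hmc := hm.mul_card
  rw [hv0']
  refine ⟨by omega, ⟨by omega, by omega, by omega⟩, ⟨by omega, by omega, by omega⟩, by omega,
    by omega, by omega, ?_⟩
  set s0 := (((((((s.setReg .ok 0).setReg .ok 1).setReg .size (2 * (m * N))).setReg .w
    (vertex A m [])).setArr .queue 0 (vertex A m [])).setArr .visited (vertex A m []) 1).setReg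
    .tail 1) with hs0
  have hL0 : Loaded A s0 := hL.frame rfl rfl rfl (by simp [hs0])
  have hsize : s0.reg .size = 2 * (m * N) := by simp [hs0]
  have hQ0 : QueueOk A m s0 := by
    refine ⟨?_, ?_, ?_, ?_⟩
    · intro i hi
      simp only [hs0, State.setReg_reg, if_true, Nat.lt_one_iff] at hi
      exact ⟨[], by simp [hs0, hi]⟩
    · intro v hv
      refine ⟨0, by simp [hs0], ?_⟩
      by_contra hne
      have : v ≠ vertex A m [] := fun h => hne (by simp [hs0, h])
      exact hv (by simp [hs0, this, hvis])
    · intro i hi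
      simp only [hs0, State.setReg_reg, if_true, Nat.lt_one_iff] at hi
      simp [hs0, hi]
    · intro i j hi hj _
      simp only [hs0, State.setReg_reg, if_true, Nat.lt_one_iff] at hi hj
      rw [hi, hj]
  -- The successors of the first `k` queue entries have been visited, and `ok` records whether these
  -- entries were all accepted correctly.
  refine Spec.loop (fun k s' => QueueOk A m s' ∧ QueueLe s0 s' ∧
    (∀ i < k, i < s'.reg .tail → ∃ w, s'.arr .queue i = vertex A m w ∧
      ∀ d, s'.arr .visited (vertex A m (w ++ [d])) ≠ 0) ∧
    (s'.reg .ok = 1 ↔ ∀ i < k, i < s'.reg .tail → ∀ w, s'.arr .queue i = vertex A m w →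
      (A.eval w ∈ accSet N s ↔ wordVal w ∈ thueMorseAffine m r))) (by decide)
    ?_ ?_ ?_ ?_
  · rw [hsize, hB.β_size]
    omega
  · exact ⟨hQ0.congr rfl rfl rfl, .of_eq rfl rfl rfl, by simp, by simp [hs0]⟩
  · rintro k s1 hk hf ha hh ⟨hQ, hle1, hclosed, hok⟩
    have hL1 := hL0.frame_loop _ _ hf ha
    have hacc1 : s1.arr .acc = s.arr .acc := (ha _ (by decide)).trans (by simp [hs0])
    have hbits1 : s1.arr .bits = s.arr .bits := (ha _ (by decide)).trans (by simp [hs0])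
    have hm1 : s1.reg .m = m := (hf _ (by decide) (by decide)).trans (by simp [hs0, hm0])
    have hr1 : s1.reg .r = r := (hf _ (by decide) (by decide)).trans (by simp [hs0, hr0])
    have hset : accSet N s1 = accSet N s := by simp [accSet, hacc1]
    simp only [spec_ite_lt, spec_skip, Expr.ok_var, Expr.eval_var, hh, true_and]
    refine ⟨fun hlt => ?_, fun hge => ⟨hQ.congr rfl rfl rfl, hle1.trans (.of_eq rfl rfl rfl), ?_, ?_⟩⟩
    · obtain ⟨w, hw⟩ := hQ.vertex k hlt
      refine (spec_processVertex hB hL1 hm hrm hm1 hr1 (by rwa [hacc1]) (by rwa [hbits1]) hQ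
        (w := w) (by rwa [hh])).mono ?_
      rintro s2 - - ⟨hQ2, hle2, hvis2, hok2⟩
      rw [hset] at hok2
      refine ⟨hQ2.congr rfl rfl rfl, (hle1.trans hle2).trans (.of_eq rfl rfl rfl), ?_, ?_⟩
      · intro i hi _
        rw [State.setReg_arr]
        rcases Nat.lt_succ_iff_lt_or_eq.1 hi with hi | rfl
        · obtain ⟨w', hw', hd⟩ := hclosed i hi (by omega)
          exact ⟨w', (hle2.queue i (by omega)).trans hw', fun d => hle2.visited _ (hd d)⟩
        · exact ⟨w, (hle2.queue i hlt).trans hw, hvis2⟩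
      · rw [State.setReg_reg, if_neg (by decide), State.setReg_arr, hok2, hok]
        constructor
        · rintro ⟨h1, h3⟩ i hi _ w' hw'
          rcases Nat.lt_succ_iff_lt_or_eq.1 hi with hi | rfl
          · exact h1 i hi (by omega) w' (by rw [← hle2.queue i (by omega), hw'])
          · have hww : vertex A m w = vertex A m w' := by rw [← hw, ← hle2.queue i hlt, hw']
            obtain ⟨e1, e2, e3⟩ := vertex_inj hm.pos hww
            rw [mem_thueMorseAffine_iff hrm] at h3 ⊢
            rwa [← e1, ← e2, ← e3]
        · intro h
          have htail := hle2.tail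
          refine ⟨fun i hi hit w' hw' => ?_, ?_⟩
          · exact h i (by omega) (hit.trans_le htail) w' ((hle2.queue i hit).trans hw')
          · exact h k (Nat.lt_succ_self k) (hlt.trans_le htail) w ((hle2.queue k hlt).trans hw)
    · intro i hi hit
      have hit' : i < s1.reg .tail := hit
      exact hclosed i (by omega) hit
    · rw [State.setReg_reg, if_neg (by decide), hok]
      refine ⟨fun h i _ hit => ?_, fun h i hi hit => h i (by omega) hit⟩
      have hit' : i < s1.reg .tail := hit
      exact h i (by omega) hit
  · rintro s1 ⟨hQ, hle1, hclosed, hok⟩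
    rw [hsize] at hclosed hok
    have htail := hQ.tail_le hm.pos
    -- Since `tail` does not exceed the number of rounds, every entry has been processed. The queue
    -- is thus closed under successors, and induction on the word applies.
    have hall : ∀ w, ∃ i < s1.reg .tail, s1.arr .queue i = vertex A m w := by
      intro w
      induction w using List.reverseRecOn with
      | nil => exact hQ.mem _ (hle1.visited _ (by simp [hs0]))
      | append_singleton w d ih =>
        obtain ⟨i, hi, hw⟩ := ih
        obtain ⟨w', hw', hd⟩ := hclosed i (by omega) hi
        obtain ⟨e1, e2, e3⟩ := vertex_inj hm.pos (hw.symm.trans hw')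
        refine hQ.mem _ ?_
        rw [vertex_append_singleton hm.pos, e1, e2, e3, ← vertex_append_singleton hm.pos]
        exact hd d
    rw [hok, eq_affine_iff_forall hB.p_pos hY]
    constructor
    · intro h
      refine ⟨hrm, fun w => ?_⟩
      obtain ⟨i, hi, hw⟩ := hall w
      exact h i (by omega) hi w hw
    · rintro ⟨-, h⟩ i _ _ w _
      exact h w

end

/-! ### The algorithm -/

/-- Decides whether the recognized set is of the form `m T + r`. -/
def decideAffine : Cmd :=
  computeBase ;; markReachable ;; removeDigits ;; findCandidate ;; computeBits ;; checkCandidate ;;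
    .ite (.eq (.var .ok) (.lit 1)) (.assign .N (.lit 1)) (.assign .N (.lit 0))

/-- The numbers of rounds of the loops. -/
def loopBound (p N : ℕ) : Var → ℕ
  | .N => N
  | .p => p
  | .base => 2 ^ p
  | .lim => 4 * (2 ^ p * N)
  | .size => 3 * (2 ^ p * N ^ 2)
  | _ => 0

/-- The initial values of variables and arrays. -/
noncomputable def initialState (p N : ℕ) (A : DFA (Fin (2 ^ p)) (Fin N)) : State where
  reg x := (RAM.inputStore p N A).reg x.toNat
  arr a := (RAM.inputStore p N A).arr a.toNat

section
variable {p N W : ℕ} {β : Var → ℕ} {A : DFA (Fin (2 ^ p)) (Fin N)}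

theorem represents_initialState : Represents (RAM.inputStore p N A) (initialState p N A) :=
  ⟨fun _ => rfl, fun _ => rfl⟩

theorem initialState_bounded (hB : Bounds p N W β) : (initialState p N A).Bounded W := by
  have hN := hB.N_le
  have hp : p < 2 ^ p := Nat.lt_two_pow_self
  have hb := hB.base_le
  have h2 := hB.two_le
  constructor
  · intro x
    simp only [initialState, RAM.inputStore]
    have := A.start.2
    split_ifs <;> omega
  · intro a j
    simp only [initialState, RAM.inputStore]
    split_ifs
    any_goals omega

theorem initialState_delta (q : Fin N) (d : Fin (2 ^ p)) :
    (initialState p N A).arr .delta (q * 2 ^ p + d) = A.step q d := by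
  have hlt := mul_add_lt_mul q.2 d.2
  have h1 : (q * 2 ^ p + d : ℕ) / 2 ^ p = q := by
    rw [mul_comm, Nat.mul_add_div (by positivity), Nat.div_eq_of_lt d.2, add_zero]
  have h2 : (q * 2 ^ p + d : ℕ) % 2 ^ p = d := by
    rw [Nat.mul_add_mod', Nat.mod_eq_of_lt d.2]
  simp only [initialState, RAM.inputStore, Arr.toNat, if_true, dif_pos hlt]
  congr

open Classical in
theorem initialState_acc (q : Fin N) :
    (initialState p N A).arr .acc q = if q ∈ A.accept then 1 else 0 := by
  simp [initialState, RAM.inputStore, Arr.toNat]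

open Classical in
theorem spec_decideAffine (hB : Bounds p N W β) {Y : Set ℕ} (hY : RecognizesSet A Y) :
    Spec W β decideAffine (initialState p N A)
      (fun s' => s'.reg .N = if IsAffine Y then 1 else 0) := by
  have hW := hB.base_le
  have h2 := hB.two_le
  set s := initialState p N A with hs
  have hzero : ∀ a : Arr, a ≠ .delta → a ≠ .acc → ∀ j, s.arr a j = 0 := by
    intro a h1 h2 j
    cases a <;> simp_all [initialState, RAM.inputStore, Arr.toNat]
  simp only [decideAffine, spec_seq]
  refine (spec_computeBase hB (by simp [hs, initialState, RAM.inputStore, Var.toNat])).mono ?_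
  intro s1 hf1 ha1 hb
  have hL1 : Loaded A s1 := by
    refine ⟨(hf1 _ (by decide)).trans ?_, hb, (hf1 _ (by decide)).trans ?_, ?_⟩
    · simp [hs, initialState, RAM.inputStore, Var.toNat]
    · simp [hs, initialState, RAM.inputStore, Var.toNat]
    · rw [ha1 _ (by decide)]
      exact initialState_delta
  refine (spec_markReachable hB hL1
    (fun j => by rw [ha1 _ (by decide)]; exact hzero _ (by decide) (by decide) j)).mono ?_
  intro s2 hf2 ha2 hreach
  have hL2 : Loaded A s2 := hL1.frame_regs _ hf2 ha2
  have hacc2 : ∀ q : Fin N, s2.arr .acc q = if q ∈ A.accept then 1 else 0 := fun q => by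
    rw [ha2 _ (by decide), ha1 _ (by decide)]
    exact initialState_acc q
  have hset : accSet N s2 = A.accept := by
    ext q
    simp [accSet, hacc2]
  refine (spec_removeDigits hB hL2 hreach (fun q => by rw [hacc2]; split_ifs <;> omega)
    (hset ▸ hY.recognizesWith)).mono ?_
  rintro s3 hf3 ha3 ⟨hacc3, Y', hY', hiff, hform⟩
  have hL3 : Loaded A s3 := hL2.frame_regs _ hf3 ha3
  refine (spec_findCandidate hB hL3 hY').mono ?_
  rintro s4 hf4 ha4 ⟨hm, hcand⟩
  have hL4 : Loaded A s4 := hL3.frame_regs _ hf4 ha4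
  refine (spec_computeBits hB hL4.base (fun j => by
    rw [ha4 _ (by decide), ha3 _ (by decide), ha2 _ (by decide), ha1 _ (by decide)]
    exact hzero _ (by decide) (by decide) j)).mono ?_
  intro s5 hf5 ha5 hbits
  have hL5 : Loaded A s5 := hL4.frame_regs _ hf5 ha5
  have hm5 : s5.reg .m = s4.reg .m := hf5 _ (by decide)
  have hr5 : s5.reg .r = s4.reg .r := hf5 _ (by decide)
  have hacc5 : s5.arr .acc = s3.arr .acc := (ha5 _ (by decide)).trans (ha4 _ (by decide))
  have hset5 : accSet N s5 = accSet N s3 := by simp [accSet, hacc5]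
  refine (spec_checkCandidate hB hL5 (by rwa [hm5]) (by rwa [hacc5]) hbits (fun j => by
    rw [ha5 _ (by decide), ha4 _ (by decide), ha3 _ (by decide), ha2 _ (by decide),
      ha1 _ (by decide)]
    exact hzero _ (by decide) (by decide) j) (hset5 ▸ hY')).mono ?_
  intro s6 _ _ hok
  -- If the check succeeds, the candidate itself witnesses that `Y'` is affine; if `Y` is affine,
  -- the search has found the right pair.
  have hfinal : s6.reg .ok = 1 ↔ IsAffine Y := by
    rw [hok, hiff, hm5, hr5]
    constructor
    · rintro ⟨hr, he⟩
      exact ⟨_, _, hr, he⟩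
    · intro h
      obtain ⟨m, r, hr, hle, he⟩ := hform h
      obtain ⟨e1, e2⟩ := hcand m r hr hle he
      rw [e1, e2]
      exact ⟨hr, he⟩
  simp only [spec_ite_eq, spec_assign, Expr.ok_var, Expr.ok_lit, Expr.eval_var, Expr.eval_lit,
    hfinal, State.setReg_reg, if_true]
  refine ⟨trivial, by omega, fun h => ⟨by omega, by rw [if_pos h]⟩,
    fun h => ⟨by omega, by rw [if_neg h]⟩⟩

theorem decideAffine_cost_le (hN : 1 ≤ N) :
    decideAffine.cost (loopBound p N) ≤ 1000 * (2 ^ p) ^ 2 * N ^ 2 := by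
  have hp : p < 2 ^ p := Nat.lt_two_pow_self
  simp only [decideAffine, computeBase, markReachable, removeDigits, findDigit, testDigit,
    shiftAccept, findCandidate, computeBits, checkCandidate, processVertex, testVertex,
    pushSuccessor, Cmd.cost, Cond.cost, Expr.cost_var, Expr.cost_lit, Expr.cost_add, Expr.cost_sub,
    Expr.cost_mul, Expr.cost_div, Expr.cost_mod, Expr.cost_get, loopBound]
  generalize 2 ^ p = b at *
  have hb : 1 ≤ b := by omega
  -- The cost is a polynomial of degree at most two in each of `b` and `N`, apart from terms in `p <
  -- b`. Each of its monomials is bounded by `b ^ 2 * N ^ 2`, and the rest is linear arithmetic.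
  have key : ∀ x y : ℕ, x ≤ b ^ 2 → y ≤ N ^ 2 → y * x ≤ N ^ 2 * b ^ 2 := fun x y hx hy =>
    Nat.mul_le_mul hy hx
  have hb0 : 1 ≤ b ^ 2 := Nat.one_le_pow _ _ hb
  have hb1 : b ≤ b ^ 2 := Nat.le_self_pow (by norm_num) _
  have hN0 : 1 ≤ N ^ 2 := Nat.one_le_pow _ _ hN
  have hN1 : N ≤ N ^ 2 := Nat.le_self_pow (by norm_num) _
  have h1 := key 1 1 hb0 hN0
  have h2 := key b 1 hb1 hN0
  have h3 := key 1 N hb0 hN1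
  have h4 := key b N hb1 hN1
  have h5 := key 1 (N ^ 2) hb0 le_rfl
  have h6 := key b (N ^ 2) hb1 le_rfl
  ring_nf at h1 h2 h3 h4 h5 h6 ⊢
  omega

end

open Classical in
theorem mainTheorem5 :
    ∃ P : RAM.Program, ∀ p : ℕ, 1 ≤ p → ∃ C : ℕ,
      ∀ (N : ℕ) (A : DFA (Fin (2 ^ p)) (Fin N)) (Y : Set ℕ), RecognizesSet A Y →
        ∃ (t : ℕ) (s : RAM.Store),
          RAM.Exec (C * N ^ 2) P (RAM.inputStore p N A) t s ∧
          t ≤ C * N ^ 2 ∧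
          s.reg 0 = (if ∃ m r : ℕ, r < m ∧ Y = thueMorseAffine m r then 1 else 0) := by
  refine ⟨decideAffine.compile, fun p hp => ⟨1000 * (2 ^ p) ^ 2, fun N A Y hY => ?_⟩⟩
  -- The initial state shows that there is at least one state.
  have hN : 1 ≤ N := (Nat.zero_le _).trans_lt A.start.2
  have hle : 4 * ((2 ^ p) ^ 2 * N ^ 2) ≤ 1000 * (2 ^ p) ^ 2 * N ^ 2 := by
    rw [mul_assoc]
    exact Nat.mul_le_mul_right _ (by norm_num)
  have hB : Bounds p N (1000 * (2 ^ p) ^ 2 * N ^ 2) (loopBound p N) :=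
    ⟨hle, hN, hp, rfl, rfl, rfl, rfl, rfl⟩
  obtain ⟨hok, hres⟩ := spec_decideAffine hB hY
  have hW := hB.base_le
  have h2 := hB.two_le
  obtain ⟨t, st, he, ht, hr, -⟩ := decideAffine.exec_compile (by omega)
    (initialState_bounded hB) hok represents_initialState
  exact ⟨t, st, he, ht.trans (decideAffine_cost_le hN), (hr.reg .N).trans hres⟩
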